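/- **Conventions.** A permutation of size $n\ge 0$ is a bijection $\sigma$ of $[n]=\{1,\dots,n\}$. The permutation $\pi$ of size $k$ is a pattern of $\sigma$ if there are $s_1<\dots<s_k$ with $\pi(j)<\pi(h)\iff\sigma(s_j)<\sigma(s_h)$ for all $j,h$; then $\mathbf s=(s_1,\dots,s_k)$ is an occurrence of $\pi$ in $\sigma$, and it is stable if $\sigma$ maps $\{s_1,\dots,s_k\}$ to itself. A permutation class is a set of permutations closed under taking patterns. $\mathcal I$ and $\mathcal D$ denote the classes of monotone increasing and of monotone decreasing permutations. A $\mathsf{TOTO}$ formula is a first-order formula with equality over two binary relation symbols $<_P,<_V$. A permutation $\sigma$ of size $n$ is a model with domain $\{(i,\sigma(i)):1\le i\le n\}$, on which $<_P$ and $<_V$ compare first and second coordinates; the point $(i,\sigma(i))$ is identified with $i$. For an occurrence $\mathbf s$ of $\pi$ (of size $k$) in $\sigma$, let $A(\sigma,\mathbf s)$ be the $(k+1)\times(k+1)$ matrix whose entry in row $i$ and column $j$ is the number of points of $\sigma$ not in $\mathbf s$ with exactly $i-1$ points of $\mathbf s$ below them and exactly $j-1$ points of $\mathbf s$ to their left.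 For a sequence $\mathbf i=(i_1,\dots,i_r)$ of distinct elements of $[k+1]$, let $A_{\mathbf i}$ be the $(k+1)\times(k+1)$ matrix with entries $1$ in positions $(i_1,i_2),\dots,(i_{r-1},i_r),(i_r,i_1)$ and $0$ elsewhere; $\mathbf i$ is a non-trivial cycle if $r\ge 2$. Let $E(\pi,\mathbf i)$ be the permutation of size $k+r$ having a stable occurrence $\mathbf s$ of $\pi$ with $A(E(\pi,\mathbf i),\mathbf s)=A_{\mathbf i}$. For permutations $\theta_1,\dots,\theta_r$, let $E(\pi,\mathbf i,(\theta_1,\dots,\theta_r))$ be obtained from $E(\pi,\mathbf i)$ by inflating (replacing by diagrams) its $r$ points outside $\mathbf s$, from left to right, by $\theta_1,\dots,\theta_r$. For $\overline{\mathcal X}=(\mathcal X_1,\dots,\mathcal X_r)$ a sequence of classes, let $E(\pi,\mathbf i,\overline{\mathcal X})$ be the class of all patterns of permutations $E(\pi,\mathbf i,(\theta_1,\dots,\theta_r))$ with $\theta_t\in\mathcal X_t$ for all $t$. **Theorem.** Let $\mathcal C$ be a permutation class and $k\ge 0$ an integer. (a) The following are equivalent. 1. There is a $\mathsf{TOTO}$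 formula $\phi(x_1,\dots,x_k)$ such that for all $\sigma\in\mathcal C$ and all sequences $\mathbf a=(a_1,\dots,a_k)$ of elements of $\sigma$, $(\sigma,\mathbf a)\models\phi$ if and only if $\mathbf a$ is a cycle of $\sigma$. 2. For each $k$-cycle $\pi\in S_k$, each non-trivial cycle $\mathbf i$ of distinct elements of $[k+1]$, and each sequence $\overline{\mathcal X}$ of the same length as $\mathbf i$ consisting of $\mathcal I$s and $\mathcal D$s, the class $\mathcal C$ avoids at least one permutation in $E(\pi,\mathbf i,\overline{\mathcal X})$. This holds both when "$\mathbf a$ is a cycle of $\sigma$" means that $k\ge1$, the $a_j$ are distinct and $\sigma(a_1)=a_2,\ \dots,\ \sigma(a_{k-1})=a_k,\ \sigma(a_k)=a_1$, and when it means only that some reordering of $\mathbf a$ has this property. (b) There is a $\mathsf{TOTO}$ formula $\phi(x_1,\dots,x_k)$ such that for all $\sigma\in\mathcal C$ and all sequences $\mathbf a=(a_1,\dots,a_k)$ of elements of $\sigma$, $(\sigma,\mathbf a)\models\phi$ if and only if the $a_j$ are distinct and $\{a_1,\dots,a_k\}$ is a union of cycles of $\sigma$, if and only if the condition in (a)2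 holds with "each $k$-cycle $\pi$" replaced by "each permutation $\pi$ of size $k$". -/

import Mathlib

namespace TOTO

open Equiv

/-! ### Permutations, patterns, permutation classes

Positions, values, and the row and column indices of matrices are numbered from `0`. -/

/-- A permutation of arbitrary finite size. -/
abbrev SizedPerm : Type := Σ n : ℕ, Perm (Fin n)

/-- `s` (listed in increasing order of positions) is an occurrence of the pattern `π` in `σ`. -/
def IsOccurrence {k n : ℕ} (π : Perm (Fin k)) (σ : Perm (Fin n)) (s : Fin k ↪o Fin n) : Prop :=
  ∀ j h : Fin k, π j < π h ↔ σ (s j) < σ (s h)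

/-- `π` is a pattern (subpermutation) of `σ`. -/
def IsPattern (π σ : SizedPerm) : Prop :=
  ∃ s : Fin π.1 ↪o Fin σ.1, IsOccurrence π.2 σ.2 s

/-- A permutation class: a set of permutations closed under taking patterns. -/
def IsPermClass (C : Set SizedPerm) : Prop :=
  ∀ σ ∈ C, ∀ π : SizedPerm, IsPattern π σ → π ∈ C

/-- The class of monotone increasing permutations. -/
def incClass : Set SizedPerm := {σ | StrictMono σ.2}

/-- The class of monotone decreasing permutations. -/
def decClass : Set SizedPerm := {σ | StrictAnti σ.2}

/-! ### First-order formulas over two orders -/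

/-- The two binary relation symbols: position order and value order. -/
inductive RelSymb : ℕ → Type
  | posLT : RelSymb 2
  | valLT : RelSymb 2

/-- The signature with the two binary relation symbols and no function symbols. -/
def lang : FirstOrder.Language.{0, 0} where
  Functions := fun _ => Empty
  Relations := RelSymb

/-- The permutation `σ` as a model: the element `i` of the domain stands for the point
`(i, σ i)` of the diagram of `σ`. -/
@[reducible] def model {n : ℕ} (σ : Perm (Fin n)) : lang.Structure (Fin n) where
  funMap := fun f _ => Empty.elim f
  RelMap := fun {_} R x =>
    match R, x with
    | RelSymb.posLT, x => x 0 < x 1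
    | RelSymb.valLT, x => σ (x 0) < σ (x 1)

/-- `(σ, a)` satisfies `φ`, where `φ` has free variables `x₁, …, x_k`. -/
def Satisfies {n k : ℕ} (σ : Perm (Fin n)) (a : Fin k → Fin n)
    (φ : lang.Formula (Fin k)) : Prop :=
  @FirstOrder.Language.Formula.Realize lang (Fin n) (model σ) (Fin k) φ a

/-! ### Cycles

Here `finRotate k` sends `0 ↦ 1 ↦ ⋯ ↦ k - 1 ↦ 0`. -/

/-- The tuple `a = (a₁, …, a_k)` is a cycle of `σ`, written in cycle notation: the `a_i` are
distinct, `k ≥ 1`, and `a₁ ↦ a₂ ↦ ⋯ ↦ a_k ↦ a₁` under `σ`. -/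
def IsCycleTuple {n k : ℕ} (σ : Perm (Fin n)) (a : Fin k → Fin n) : Prop :=
  0 < k ∧ Function.Injective a ∧ ∀ t, σ (a t) = a (finRotate k t)

/-- The entries of `a` are, in some order, the `k` distinct elements of one cycle of `σ`. -/
def IsCycleSet {n k : ℕ} (σ : Perm (Fin n)) (a : Fin k → Fin n) : Prop :=
  ∃ e : Perm (Fin k), IsCycleTuple σ (a ∘ e)

/-- The entries of `a` are distinct and their set is a union of cycles of `σ`. -/
def IsUnionOfCycles {n k : ℕ} (σ : Perm (Fin n)) (a : Fin k → Fin n) : Prop :=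
  Function.Injective a ∧ ∀ t y, σ.SameCycle (a t) y → y ∈ Set.range a

/-- `π` is a `k`-cycle in `S_k`; for `k = 1` this is the identity of `S_1`. -/
def IsFullCycle {k : ℕ} (π : Perm (Fin k)) : Prop :=
  ∃ a : Fin k → Fin k, IsCycleTuple π a

/-! ### Expansions and inflations -/

/-- A stable occurrence of `π` in `σ`: an occurrence whose set of elements is mapped to itself. -/
def IsStableOccurrence {k n : ℕ} (π : Perm (Fin k)) (σ : Perm (Fin n))
    (s : Fin k ↪o Fin n) : Prop :=
  IsOccurrence π σ s ∧ Set.MapsTo σ (Set.range s) (Set.range s)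

/-- The matrix `A(σ, s)` of cell sizes: the entry in row `i` and column `j` is the number of points
of `σ` not in `s` with exactly `i` points of `s` below them and exactly `j` points of `s` to their
left. -/
def cellMatrix {k n : ℕ} (σ : Perm (Fin n)) (s : Fin k ↪o Fin n) :
    Matrix (Fin (k + 1)) (Fin (k + 1)) ℕ :=
  Matrix.of fun i j =>
    (Finset.univ.filter fun x : Fin n =>
      (∀ l, s l ≠ x) ∧
      (Finset.univ.filter fun l => σ (s l) < σ x).card = i.val ∧
      (Finset.univ.filter fun l => s l < x).card = j.val).card

/-- The cycle matrix `A_i` of `i = (i₁, …, i_r)`: entries `1` in the positions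
`(i₁, i₂), …, (i_{r-1}, i_r), (i_r, i₁)` and `0` elsewhere. -/
def cycleMatrix {m r : ℕ} (i : Fin r → Fin m) : Matrix (Fin m) (Fin m) ℕ :=
  Matrix.of fun a b => if ∃ t, i t = a ∧ i (finRotate r t) = b then 1 else 0

/-- `E`, of size `k + r`, with the marked points `s`, is the expansion `E(π, i)` of `π` by `i`. -/
def IsExpansion {k r : ℕ} (π : Perm (Fin k)) (i : Fin r → Fin (k + 1))
    (E : Perm (Fin (k + r))) (s : Fin k ↪o Fin (k + r)) : Prop :=
  IsStableOccurrence π E s ∧ cellMatrix E s = cycleMatrix i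

/-- `ρ` is the inflation `α[θ₁, …, θ_n]`: each point of `α` is replaced by the diagram of the
corresponding `θ_j`. The point `x` of the `j`-th block is the point of `ρ` in position
`e ⟨j, x⟩`. -/
def IsInflation {n : ℕ} (α : Perm (Fin n)) (θ : Fin n → SizedPerm) (ρ : SizedPerm) : Prop :=
  ∃ e : (Σ j : Fin n, Fin (θ j).1) ≃ Fin ρ.1,
    (∀ j x y, e ⟨j, x⟩ < e ⟨j, y⟩ ↔ x < y) ∧
    (∀ j x y, ρ.2 (e ⟨j, x⟩) < ρ.2 (e ⟨j, y⟩) ↔ (θ j).2 x < (θ j).2 y) ∧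
    (∀ j j' x y, j < j' → e ⟨j, x⟩ < e ⟨j', y⟩) ∧
    (∀ j j' x y, α j < α j' → ρ.2 (e ⟨j, x⟩) < ρ.2 (e ⟨j', y⟩))

/-- `ρ` is `E(π, i, Θ)`: the inflation of `E(π, i)` in which the unmarked points `u₁ < ⋯ < u_r`,
listed from left to right, are inflated by `Θ₁, …, Θ_r`, and the marked points are kept. -/
def IsInflatedExpansion {k r : ℕ} (π : Perm (Fin k)) (i : Fin r → Fin (k + 1))
    (Θ : Fin r → SizedPerm) (ρ : SizedPerm) : Prop :=
  ∃ (E : Perm (Fin (k + r))) (s : Fin k ↪o Fin (k + r)) (u : Fin r ↪o Fin (k + r))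
    (θ : Fin (k + r) → SizedPerm),
    IsExpansion π i E s ∧ Set.range u = (Set.range s)ᶜ ∧
    (∀ j, θ (s j) = ⟨1, 1⟩) ∧ (∀ t, θ (u t) = Θ t) ∧ IsInflation E θ ρ

/-- The class `E(π, i, X̄)`: all patterns of the permutations `E(π, i, Θ)` with `Θ_t ∈ X_t`. -/
def inflationClass {k r : ℕ} (π : Perm (Fin k)) (i : Fin r → Fin (k + 1))
    (X : Fin r → Set SizedPerm) : Set SizedPerm :=
  {τ | ∃ (Θ : Fin r → SizedPerm) (ρ : SizedPerm),
    (∀ t, Θ t ∈ X t) ∧ IsInflatedExpansion π i Θ ρ ∧ IsPattern τ ρ}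

/-- For each non-trivial cycle `i` of `r ≥ 2` distinct elements of a `(k + 1)`-element set, and each
sequence `X̄` of length `r` consisting of the increasing and the decreasing class, `C` avoids at
least one permutation of `E(π, i, X̄)`. -/
def AvoidsSomeInEach {k : ℕ} (C : Set SizedPerm) (π : Perm (Fin k)) : Prop :=
  ∀ (r : ℕ), 2 ≤ r → ∀ i : Fin r → Fin (k + 1), Function.Injective i →
    ∀ X : Fin r → Set SizedPerm, (∀ t, X t = incClass ∨ X t = decClass) →
      ∃ τ ∈ inflationClass π i X, τ ∉ C

end TOTO

namespace TOTO

open Equiv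

/-! Mark the points of an occurrence `s` of `π` in `σ`. In increasing order, the positions and the
values of the marked points are two increasing tuples, and `s` is stable iff the tuples coincide. An
increasing tuple is determined by the number of unmarked entries in each of its gaps. For positions
these are the column sums of the cell matrix, for values the row sums, so stable means balanced
(`IsOccurrence.stable_iff_balanced`). Diagonal cells play no role.

Definability. A balanced matrix is a circulation, so one very large off-diagonal entry forces a
non-trivial cycle of large entries (`exists_heavy_cycle`). Each large cell contains a long monotone
sequence, and these sequences realize any prescribed small inflations of the expansion along this
cycle whose blocks have the matching monotone directions (`IsInflatedExpansion.isPattern`). If the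
class avoids something in every inflation class of `π`, the off-diagonal entries at stable
occurrences are therefore bounded (`AvoidsSomeInEach.exists_entry_bound`), and stability is a finite
disjunction of exact counting conditions.

Undefinability. If the class contains an entire inflation class, inflate all new points of the
expansion by monotone blocks of one common size: the marked occurrence is stable. One more point in
one block makes it unstable, but a fixed formula cannot notice this once the block is long
(`ShiftFamily.realize_iff_of_long_interval`, `exists_indistinguishable`).

The three properties of tuples all force the set of entries to be invariant, and on a stable
occurrence they depend only on `π` and the listing order; `expressible_iff_forall_avoids` treats
them together. -/

/-! ### Back-and-forth along a family of embeddings -/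

open FirstOrder in
/-- A family of embeddings `emb c : M ↪ M'`, such that, as `c` varies in `[0, N]`, the image of a
point and the preimage of a point each change at most once. -/
structure ShiftFamily (L : FirstOrder.Language.{0, 0}) (M M' : Type) [L.Structure M] [L.Structure M']
    (N : ℕ) where
  emb : ℕ → M ↪[L] M'
  image_jump : ∀ x, ∃ p, (∀ c ≤ p, ∀ c' ≤ p, emb c x = emb c' x) ∧
    ∀ c > p, ∀ c' > p, emb c x = emb c' x
  preimage_jump : ∀ y, ∃ p, (p = 0 ∨ ∃ x, ∀ c < p, c ≤ N → emb c x = y) ∧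
    (N ≤ p ∨ ∃ x, ∀ c > p, c ≤ N → emb c x = y)

open FirstOrder FirstOrder.Language in
/-- Back-and-forth along a shift family: tuples of `M` whose image under `emb c` does not depend on
`c` in a long interval satisfy the same formulas as their images. -/
theorem ShiftFamily.realize_iff_of_long_interval {L : FirstOrder.Language.{0, 0}} {α : Type} {m : ℕ}
    (φ : L.BoundedFormula α m) :
    ∃ d : ℕ, ∀ (M M' : Type) [L.Structure M] [L.Structure M'] (N : ℕ) (g : ShiftFamily L M M' N)
      (lo hi : ℕ), lo + d ≤ hi → hi ≤ N → ∀ (v : α → M) (xs : Fin m → M) (v' : α → M')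
      (xs' : Fin m → M'), (∀ c, lo ≤ c → c ≤ hi → ∀ i, g.emb c (v i) = v' i) →
      (∀ c, lo ≤ c → c ≤ hi → ∀ i, g.emb c (xs i) = xs' i) →
      (φ.Realize v xs ↔ φ.Realize v' xs') := by
  induction φ with
  | falsum => exact ⟨0, fun M M' _ _ N g lo hi _ _ v xs v' xs' _ _ => Iff.rfl⟩
  | equal t₁ t₂ =>
    refine ⟨0, fun M M' _ _ N g lo hi h1 h2 v xs v' xs' hv hx => ?_⟩
    have e : Sum.elim v' xs' = g.emb lo ∘ Sum.elim v xs := by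
      funext i
      rcases i with i | i
      · exact (hv lo le_rfl (by omega) i).symm
      · exact (hx lo le_rfl (by omega) i).symm
    simp only [BoundedFormula.Realize, e, HomClass.realize_term]
    exact (g.emb lo).injective.eq_iff.symm
  | rel R ts =>
    refine ⟨0, fun M M' _ _ N g lo hi h1 h2 v xs v' xs' hv hx => ?_⟩
    have e : Sum.elim v' xs' = g.emb lo ∘ Sum.elim v xs := by
      funext i
      rcases i with i | i
      · exact (hv lo le_rfl (by omega) i).symm
      · exact (hx lo le_rfl (by omega) i).symm
    simp only [BoundedFormula.Realize, e, HomClass.realize_term]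
    exact ((g.emb lo).map_rel R _).symm
  | imp φ ψ ih₁ ih₂ =>
    obtain ⟨d₁, h₁⟩ := ih₁
    obtain ⟨d₂, h₂⟩ := ih₂
    refine ⟨max d₁ d₂, fun M M' _ _ N g lo hi h1 h2 v xs v' xs' hv hx => ?_⟩
    simp only [BoundedFormula.realize_imp]
    rw [h₁ M M' N g lo hi (by omega) h2 v xs v' xs' hv hx,
      h₂ M M' N g lo hi (by omega) h2 v xs v' xs' hv hx]
  | @all m φ ih =>
    obtain ⟨d, hd⟩ := ih
    -- The newly chosen element has a single jump `p`. Cutting the interval at `p` leaves a piece of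
    -- length at least `d` on one side, and on that piece the element and its partner correspond for
    -- all `c`.
    refine ⟨2 * d + 2, fun M M' _ _ N g lo hi h1 h2 v xs v' xs' hv hx => ?_⟩
    have key : ∀ lo' hi' : ℕ, lo ≤ lo' → lo' + d ≤ hi' → hi' ≤ hi → ∀ x y,
        (∀ c, lo' ≤ c → c ≤ hi' → g.emb c x = y) →
        (φ.Realize v (Fin.snoc xs x) ↔ φ.Realize v' (Fin.snoc xs' y)) := by
      intro lo' hi' a1 a2 a3 x y hxy
      refine hd M M' N g lo' hi' a2 (by omega) v _ v' _
        (fun c c1 c2 => hv c (by omega) (by omega)) (fun c c1 c2 i => ?_)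
      refine Fin.lastCases ?_ (fun i => ?_) i
      · simpa using hxy c c1 c2
      · simpa using hx c (by omega) (by omega) i
    simp only [BoundedFormula.realize_all]
    constructor
    · intro h y
      obtain ⟨p, hp1, hp2⟩ := g.preimage_jump y
      by_cases hp : lo + d + 1 ≤ p
      · obtain ⟨x, hx'⟩ := hp1.resolve_left (by omega)
        exact (key lo (min (p - 1) hi) le_rfl (by omega) (by omega) x y
          fun c c1 c2 => hx' c (by omega) (by omega)).1 (h x)
      · obtain ⟨x, hx'⟩ := hp2.resolve_left (by omega)
        exact (key (max (p + 1) lo) hi (by omega) (by omega) le_rfl x y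
          fun c c1 c2 => hx' c (by omega) (by omega)).1 (h x)
    · intro h x
      obtain ⟨p, hp1, hp2⟩ := g.image_jump x
      by_cases hp : lo + d + 1 ≤ p
      · exact (key lo (min p hi) le_rfl (by omega) (by omega) x (g.emb lo x)
          fun c c1 c2 => hp1 c (by omega) _ (by omega)).2 (h _)
      · exact (key (max (p + 1) lo) hi (by omega) (by omega) le_rfl x (g.emb hi x)
          fun c c1 c2 => hp2 c (by omega) _ (by omega)).2 (h _)

/-! ### First-order definable properties of tuples -/

/-- The property `P` of tuples of elements of a permutation is expressed by a formula. -/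
def Definable {α : Type} (P : ∀ n : ℕ, Perm (Fin n) → (α → Fin n) → Prop) : Prop :=
  ∃ φ : lang.Formula α, ∀ n (σ : Perm (Fin n)) (a : α → Fin n),
    @FirstOrder.Language.Formula.Realize lang (Fin n) (model σ) α φ a ↔ P n σ a

namespace Definable

variable {α : Type}

theorem posLT (x y : α) : Definable fun _ _ (a : α → _) => a x < a y :=
  ⟨FirstOrder.Language.Relations.formula₂ (L := lang) RelSymb.posLT (.var x) (.var y),
    fun n σ a => by
      let _ := model σ
      exact FirstOrder.Language.Formula.realize_rel₂⟩

theorem valLT (x y : α) : Definable fun _ σ (a : α → _) => σ (a x) < σ (a y) :=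
  ⟨FirstOrder.Language.Relations.formula₂ (L := lang) RelSymb.valLT (.var x) (.var y),
    fun n σ a => by
      let _ := model σ
      exact FirstOrder.Language.Formula.realize_rel₂⟩

theorem eq (x y : α) : Definable fun _ _ (a : α → _) => a x = a y :=
  ⟨FirstOrder.Language.Term.equal (.var x) (.var y), fun n σ a => by
    let _ := model σ
    exact FirstOrder.Language.Formula.realize_equal⟩

theorem not {P : ∀ n : ℕ, Perm (Fin n) → (α → Fin n) → Prop} (h : Definable P) :
    Definable fun n σ a => ¬ P n σ a := by
  obtain ⟨φ, hφ⟩ := h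
  refine ⟨φ.not, fun n σ a => ?_⟩
  let _ := model σ
  exact FirstOrder.Language.Formula.realize_not.trans (not_congr (hφ n σ a))

theorem forall_finite {β : Type} [Finite β] {P : β → ∀ n : ℕ, Perm (Fin n) → (α → Fin n) → Prop}
    (h : ∀ b, Definable (P b)) : Definable fun n σ a => ∀ b, P b n σ a := by
  choose φ hφ using h
  refine ⟨FirstOrder.Language.Formula.iInf φ, fun n σ a => ?_⟩
  simp only [← hφ]
  let _ := model σ
  exact FirstOrder.Language.Formula.realize_iInf

theorem exists_finite {β : Type} [Finite β] {P : β → ∀ n : ℕ, Perm (Fin n) → (α → Fin n) → Prop}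
    (h : ∀ b, Definable (P b)) : Definable fun n σ a => ∃ b, P b n σ a := by
  choose φ hφ using h
  refine ⟨FirstOrder.Language.Formula.iSup φ, fun n σ a => ?_⟩
  simp only [← hφ]
  let _ := model σ
  exact FirstOrder.Language.Formula.realize_iSup

theorem const (p : Prop) : Definable fun _ _ (_ : α → _) => p := by
  by_cases hp : p
  · simpa [hp] using forall_finite (α := α) (β := Empty) (P := fun _ _ _ _ => False) (by simp)
  · simpa [hp] using exists_finite (α := α) (β := Empty) (P := fun _ _ _ _ => False) (by simp)

theorem and {P Q : ∀ n : ℕ, Perm (Fin n) → (α → Fin n) → Prop} (hP : Definable P)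
    (hQ : Definable Q) : Definable fun n σ a => P n σ a ∧ Q n σ a := by
  simpa [and_comm] using
    forall_finite (P := fun b : Bool => if b then P else Q) (by simp [hP, hQ])

theorem imp {P Q : ∀ n : ℕ, Perm (Fin n) → (α → Fin n) → Prop} (hP : Definable P)
    (hQ : Definable Q) : Definable fun n σ a => P n σ a → Q n σ a := by
  simpa using (hP.and hQ.not).not

theorem iff {P Q : ∀ n : ℕ, Perm (Fin n) → (α → Fin n) → Prop} (hP : Definable P)
    (hQ : Definable Q) : Definable fun n σ a => P n σ a ↔ Q n σ a := by
  simpa [iff_iff_implies_and_implies] using (hP.imp hQ).and (hQ.imp hP)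

theorem exists_tuple {β : Type} [Finite β]
    {P : ∀ n : ℕ, Perm (Fin n) → (α ⊕ β → Fin n) → Prop} (hP : Definable P) :
    Definable fun n σ (a : α → Fin n) => ∃ y : β → Fin n, P n σ (Sum.elim a y) := by
  obtain ⟨φ, hφ⟩ := hP
  refine ⟨φ.iExs β, fun n σ a => ?_⟩
  simp only [← hφ]
  let _ := model σ
  exact FirstOrder.Language.Formula.realize_iExs

theorem relabel {β : Type} {P : ∀ n : ℕ, Perm (Fin n) → (α → Fin n) → Prop} (hP : Definable P)
    (f : α → β) : Definable fun n σ (a : β → Fin n) => P n σ (a ∘ f) := by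
  obtain ⟨φ, hφ⟩ := hP
  refine ⟨φ.relabel f, fun n σ a => ?_⟩
  simp only [← hφ]
  let _ := model σ
  exact FirstOrder.Language.Formula.realize_relabel

/-- Exact counting: the number of elements `x` such that `(a, x)` satisfies a definable property
is definably equal to `m`. -/
theorem card_eq {P : ∀ n : ℕ, Perm (Fin n) → (α ⊕ Unit → Fin n) → Prop} (hP : Definable P)
    (m : ℕ) : Definable fun n σ (a : α → Fin n) =>
      Nat.card {x : Fin n // P n σ (Sum.elim a fun _ => x)} = m := by
  have ge : ∀ m : ℕ, Definable fun n σ (a : α → Fin n) =>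
      m ≤ Nat.card {x : Fin n // P n σ (Sum.elim a fun _ => x)} := by
    intro m
    have h1 : Definable fun n σ (b : α ⊕ Fin m → Fin n) =>
        (∀ i j : Fin m, b (.inr i) = b (.inr j) → i = j) ∧
          ∀ i : Fin m, P n σ (b ∘ Sum.map id fun _ => i) :=
      (forall_finite fun i => forall_finite fun j => (eq _ _).imp (const _)).and
        (forall_finite fun i => hP.relabel _)
    obtain ⟨φ, hφ⟩ := h1.exists_tuple
    refine ⟨φ, fun n σ a => (hφ n σ a).trans ?_⟩
    have e : ∀ (y : Fin m → Fin n) i,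
        (Sum.elim a y ∘ Sum.map id fun _ : Unit => i) = Sum.elim a fun _ => y i := by
      intro y i
      funext t
      rcases t with t | t <;> rfl
    simp only [e, Sum.elim_inr]
    constructor
    · rintro ⟨y, h1, h2⟩
      have := Nat.card_le_card_of_injective
        (fun i : Fin m => (⟨y i, h2 i⟩ : {x : Fin n // P n σ (Sum.elim a fun _ => x)}))
        fun i j hij => h1 i j (by simpa using hij)
      simpa using this
    · intro h
      let E := Finite.equivFin {x : Fin n // P n σ (Sum.elim a fun _ => x)}
      exact ⟨fun i => (E.symm (Fin.castLE h i)).1,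
        fun i j hij => by simpa using E.symm.injective (Subtype.ext hij),
        fun i => (E.symm (Fin.castLE h i)).2⟩
  obtain ⟨φ, hφ⟩ := (ge m).and (ge (m + 1)).not
  exact ⟨φ, fun n σ a => (hφ n σ a).trans (by omega)⟩

end Definable

/-! ### Monotone subsequences -/

/-- A weak form of the Erdős–Szekeres theorem. -/
theorem exists_monotone_subset {ι κ : Type*} [LinearOrder ι] [LinearOrder κ] (f : ι → κ)
    (hf : Function.Injective f) (a b : ℕ) :
    ∀ S : Finset ι, 2 ^ (a + b) ≤ S.card →
      (∃ T ⊆ S, T.card = a ∧ StrictMonoOn f T) ∨ ∃ T ⊆ S, T.card = b ∧ StrictAntiOn f T := by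
  suffices H : ∀ n a b, a + b = n → ∀ S : Finset ι, 2 ^ n ≤ S.card →
      (∃ T ⊆ S, T.card = a ∧ StrictMonoOn f T) ∨ ∃ T ⊆ S, T.card = b ∧ StrictAntiOn f T from
    H _ a b rfl
  intro n
  induction n with
  | zero =>
    intro a b h S _
    exact .inl ⟨∅, by simp, by simp; omega, by simp [StrictMonoOn]⟩
  | succ n ih =>
    intro a b h S hS
    rcases Nat.eq_zero_or_pos a with rfl | ha
    · exact .inl ⟨∅, by simp, by simp, by simp [StrictMonoOn]⟩
    rcases Nat.eq_zero_or_pos b with rfl | hb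
    · exact .inr ⟨∅, by simp, by simp, by simp [StrictAntiOn]⟩
    have hne : S.Nonempty := Finset.card_pos.1 (lt_of_lt_of_le (by positivity) hS)
    set p := S.min' hne with hp
    have hmin : ∀ x ∈ S, x ≠ p → p < x := fun x hx hxp =>
      lt_of_le_of_ne (S.min'_le x hx) (Ne.symm hxp)
    have hpS : p ∈ S := S.min'_mem hne
    -- Pigeonhole around the leftmost point `p`: it lengthens an increasing set taken above it, or a
    -- decreasing set taken below it.
    have hsplit : 2 ^ n ≤ (S.filter fun x => f p < f x).card ∨
        2 ^ n ≤ (S.filter fun x => f x < f p).card := by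
      have h1 := Finset.card_filter_add_card_filter_not (s := S) fun x => f p < f x
      have h2 : (S.filter fun x => ¬ f p < f x) ⊆ insert p (S.filter fun x => f x < f p) := by
        intro x hx
        simp only [Finset.mem_filter, Finset.mem_insert, not_lt] at hx ⊢
        exact (hx.2.eq_or_lt).imp (fun h => hf h) fun h => ⟨hx.1, h⟩
      have h3 := (Finset.card_le_card h2).trans (Finset.card_insert_le _ _)
      rw [pow_succ] at hS
      omega
    have extend : ∀ T ⊆ S, (∀ x ∈ T, f x ≠ f p) →
        insert p T ⊆ S ∧ (insert p T).card = T.card + 1 ∧ ∀ x ∈ T, p < x := by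
      intro T hT hTp
      have hpT : p ∉ T := fun h => hTp p h rfl
      exact ⟨Finset.insert_subset hpS hT, Finset.card_insert_of_notMem hpT,
        fun x hx => hmin x (hT hx) fun e => hpT (e ▸ hx)⟩
    rcases hsplit with h | h
    · rcases ih (a - 1) b (by omega) _ h with ⟨T, hT, hc, hm⟩ | ⟨T, hT, hc, hm⟩
      · have hTf : ∀ x ∈ T, f p < f x := fun x hx => (Finset.mem_filter.1 (hT hx)).2
        obtain ⟨e1, e2, e3⟩ := extend T (hT.trans (Finset.filter_subset _ _))
          fun x hx => (hTf x hx).ne'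
        refine .inl ⟨_, e1, by omega, ?_⟩
        rw [Finset.coe_insert]
        rintro x (rfl | hx) y (rfl | hy) hxy
        · exact absurd hxy (lt_irrefl _)
        · exact hTf y hy
        · exact absurd hxy (e3 x hx).not_gt
        · exact hm hx hy hxy
      · exact .inr ⟨T, hT.trans (Finset.filter_subset _ _), hc, hm⟩
    · rcases ih a (b - 1) (by omega) _ h with ⟨T, hT, hc, hm⟩ | ⟨T, hT, hc, hm⟩
      · exact .inl ⟨T, hT.trans (Finset.filter_subset _ _), hc, hm⟩
      · have hTf : ∀ x ∈ T, f x < f p := fun x hx => (Finset.mem_filter.1 (hT hx)).2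
        obtain ⟨e1, e2, e3⟩ := extend T (hT.trans (Finset.filter_subset _ _))
          fun x hx => (hTf x hx).ne
        refine .inr ⟨_, e1, by omega, ?_⟩
        rw [Finset.coe_insert]
        rintro x (rfl | hx) y (rfl | hy) hxy
        · exact absurd hxy (lt_irrefl _)
        · exact hTf y hy
        · exact absurd hxy (e3 x hx).not_gt
        · exact hm hx hy hxy

/-! ### Stable occurrences and balanced matrices -/

/-- The number of marked points `p l` below `y`. -/
def numBelow {k : ℕ} {β : Type*} [LinearOrder β] (p : Fin k → β) (y : β) : ℕ :=
  (Finset.univ.filter fun l => p l < y).card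

section numBelow

variable {k : ℕ} {β : Type*} [LinearOrder β]

theorem numBelow_comp_perm (p : Fin k → β) (π : Perm (Fin k)) (y : β) :
    numBelow (p ∘ π) y = numBelow p y :=
  Finset.card_equiv π (by simp)

theorem numBelow_le (p : Fin k → β) (y : β) : numBelow p y ≤ k := by
  simpa [numBelow] using Finset.card_filter_le Finset.univ fun l => p l < y

theorem numBelow_mono (p : Fin k → β) : Monotone (numBelow p) := fun _ _ h =>
  Finset.card_le_card fun l hl => by
    simp only [Finset.mem_filter, Finset.mem_univ, true_and] at hl ⊢
    exact hl.trans_le h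

theorem numBelow_apply {p : Fin k → β} (hp : StrictMono p) (l : Fin k) : numBelow p (p l) = l := by
  simp only [numBelow, hp.lt_iff_lt]
  simpa [Finset.Iio, Finset.filter_gt_eq_Iio] using Fin.card_Iio l

theorem numBelow_lt_numBelow {p : Fin k → β} {l : Fin k} {y : β} (h : p l < y) :
    numBelow p (p l) < numBelow p y :=
  Finset.card_lt_card <| Finset.ssubset_iff_of_subset (fun j hj => by
    simp only [Finset.mem_filter, Finset.mem_univ, true_and] at hj ⊢
    exact hj.trans h) |>.2 ⟨l, by simp [h]⟩

theorem numBelow_le_iff {p : Fin k → β} (hp : StrictMono p) (l : Fin k) (y : β) :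
    numBelow p y ≤ l ↔ y ≤ p l := by
  refine ⟨fun h => not_lt.1 fun hlt => ?_, fun h => ?_⟩
  · have := numBelow_lt_numBelow hlt
    rw [numBelow_apply hp] at this
    omega
  · simpa [numBelow_apply hp] using numBelow_mono p h

end numBelow

/-- The number of unmarked points with exactly `m` marked points below them. -/
def gapCount {k n : ℕ} (p : Fin k → Fin n) (m : ℕ) : ℕ :=
  (Finset.univ.filter fun y => (∀ l, p l ≠ y) ∧ numBelow p y = m).card

theorem gapCount_comp_perm {k n : ℕ} (p : Fin k → Fin n) (π : Perm (Fin k)) (m : ℕ) :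
    gapCount (p ∘ π) m = gapCount p m := by
  have : ∀ y, (∀ l, (p ∘ π) l ≠ y) ↔ ∀ l, p l ≠ y := fun y =>
    π.forall_congr_left.trans (by simp)
  simp only [gapCount, numBelow_comp_perm, this]

/-- Below the marked point number `l` lie `l` marked points and all unmarked points of the gaps `0,
…, l`. Hence gap counts determine an increasing tuple. -/
theorem val_eq_add_sum_gapCount {k n : ℕ} {p : Fin k → Fin n} (hp : StrictMono p) (l : Fin k) :
    (p l : ℕ) = l + ∑ m ∈ Finset.range (l + 1), gapCount p m := by
  have h1 : (p l : ℕ) = (Finset.Iio (p l)).card := by simp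
  have h2 := Finset.card_filter_add_card_filter_not (s := Finset.Iio (p l)) fun y => ∃ j, p j = y
  have h3 : ((Finset.Iio (p l)).filter fun y => ∃ j, p j = y) = (Finset.Iio l).map ⟨p, hp.injective⟩ := by
    ext y
    simp only [Finset.mem_filter, Finset.mem_Iio, Finset.mem_map, Function.Embedding.coeFn_mk]
    constructor
    · rintro ⟨h, j, rfl⟩
      exact ⟨j, hp.lt_iff_lt.1 h, rfl⟩
    · rintro ⟨j, h, rfl⟩
      exact ⟨hp h, j, rfl⟩
  have h4 := Finset.card_eq_sum_card_fiberwise (f := numBelow p) (t := Finset.range (l + 1))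
    (s := (Finset.Iio (p l)).filter fun y => ¬ ∃ j, p j = y) (by
      intro y hy
      simp only [Finset.coe_filter, Finset.mem_Iio, Set.mem_ofPred_eq] at hy
      simpa [Nat.lt_succ_iff] using (numBelow_le_iff hp l y).2 hy.1.le)
  rw [h1, ← h2, h3, h4]
  simp only [Finset.card_map, Fin.card_Iio, add_right_inj]
  refine Finset.sum_congr rfl fun m hm => ?_
  rw [gapCount, Finset.filter_filter]
  congr 1
  ext y
  simp only [Finset.mem_filter, Finset.mem_Iio, Finset.mem_univ, true_and, not_exists]
  constructor
  · rintro ⟨h, h', h''⟩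
    exact ⟨h', h''⟩
  · rintro ⟨h', h''⟩
    refine ⟨lt_of_le_of_ne ((numBelow_le_iff hp l y).1 ?_) (Ne.symm (h' l)), h', h''⟩
    rw [h'']
    exact Nat.lt_succ_iff.1 (Finset.mem_range.1 hm)

theorem eq_of_gapCount_eq {k n : ℕ} {p p' : Fin k → Fin n} (hp : StrictMono p)
    (hp' : StrictMono p') (h : ∀ m ≤ k, gapCount p m = gapCount p' m) : p = p' := by
  funext l
  apply Fin.ext
  rw [val_eq_add_sum_gapCount hp, val_eq_add_sum_gapCount hp']
  congr 1
  refine Finset.sum_congr rfl fun m hm => h m ?_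
  have := Finset.mem_range.1 hm
  omega

section Stable

variable {k n : ℕ} {π : Perm (Fin k)} {σ : Perm (Fin n)} {s : Fin k ↪o Fin n}

theorem IsOccurrence.strictMono (h : IsOccurrence π σ s) : StrictMono fun l => σ (s (π.symm l)) :=
  fun a b hab => (h _ _).1 (by simpa using hab)

/-- A stable occurrence of `π` is one on which `σ` acts as `π` does. -/
theorem IsOccurrence.stable_iff_apply (h : IsOccurrence π σ s) :
    IsStableOccurrence π σ s ↔ ∀ l, σ (s l) = s (π l) := by
  refine ⟨fun hs => ?_, fun hs => ⟨h, ?_⟩⟩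
  · choose f hf using fun l => hs.2 ⟨l, rfl⟩
    have hmono : StrictMono (f ∘ π.symm) := fun a b hab => by
      have := h.strictMono hab
      simpa only [← hf, s.lt_iff_lt, Function.comp_apply] using this
    have hsurj : Function.Surjective (f ∘ π.symm) :=
      Finite.surjective_of_injective hmono.injective
    -- A strictly increasing self-map of `Fin k` can only be the identity.
    have hid : f ∘ π.symm = id :=
      (StrictMono.range_inj hmono strictMono_id).1 (by rw [hsurj.range_eq, Set.range_id])
    intro l
    have := congrFun hid (π l)
    simp only [Function.comp_apply, symm_apply_apply, id] at this
    rw [← hf, this]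
  · rintro _ ⟨l, rfl⟩
    exact ⟨π l, (hs l).symm⟩

/-- Equal row and column sums. -/
def Balanced {m : ℕ} (A : Matrix (Fin m) (Fin m) ℕ) : Prop := ∀ i, ∑ j, A i j = ∑ j, A j i

theorem sum_col_cellMatrix (σ : Perm (Fin n)) (s : Fin k ↪o Fin n) (m : Fin (k + 1)) :
    ∑ j, cellMatrix σ s j m = gapCount s m := by
  rw [gapCount, Finset.card_eq_sum_card_fiberwise
    (f := fun x => (⟨numBelow (σ ∘ s) (σ x), Nat.lt_succ_iff.2 (numBelow_le _ _)⟩ : Fin (k + 1)))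
    (t := Finset.univ) (by simp [Set.MapsTo])]
  refine Finset.sum_congr rfl fun j _ => ?_
  simp only [cellMatrix, Matrix.of_apply, Finset.filter_filter, Fin.ext_iff]
  congr 1
  ext x
  simp only [Finset.mem_filter, numBelow, Function.comp]
  tauto

/-- Reindexing by `σ` replaces points by their values, so rows count unmarked values as columns
count unmarked positions. -/
theorem sum_row_cellMatrix (σ : Perm (Fin n)) (s : Fin k ↪o Fin n) (m : Fin (k + 1)) :
    ∑ j, cellMatrix σ s m j = gapCount (σ ∘ s) m := by
  have e : gapCount (σ ∘ s) m = (Finset.univ.filter fun x =>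
      (∀ l, s l ≠ x) ∧ numBelow (σ ∘ s) (σ x) = m).card :=
    (Finset.card_equiv σ (by simp)).symm
  rw [e, Finset.card_eq_sum_card_fiberwise
    (f := fun x => (⟨numBelow s x, Nat.lt_succ_iff.2 (numBelow_le _ _)⟩ : Fin (k + 1)))
    (t := Finset.univ) (by simp [Set.MapsTo])]
  refine Finset.sum_congr rfl fun j _ => ?_
  simp only [cellMatrix, Matrix.of_apply, Finset.filter_filter, Fin.ext_iff]
  congr 1
  ext x
  simp only [Finset.mem_filter, numBelow, Function.comp]
  tauto

/-- Stability says that the sorted values of the marked points are their positions. Both tuples are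
increasing, so this is equality of gap counts, that is, of row and column sums. -/
theorem IsOccurrence.stable_iff_balanced (h : IsOccurrence π σ s) :
    IsStableOccurrence π σ s ↔ Balanced (cellMatrix σ s) := by
  have e : (fun l => σ (s (π.symm l))) = (σ ∘ s) ∘ π.symm := rfl
  have hc : ∀ m, gapCount (σ ∘ s) m = gapCount (fun l => σ (s (π.symm l))) m := fun m => by
    rw [e, gapCount_comp_perm]
  have key : (∀ l, σ (s l) = s (π l)) ↔ (fun l => σ (s (π.symm l))) = s := by
    rw [funext_iff, π.forall_congr_left]
    simp
  rw [h.stable_iff_apply, key]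
  simp only [Balanced, sum_col_cellMatrix, sum_row_cellMatrix, hc]
  refine ⟨fun hs i => by rw [hs], fun hb => eq_of_gapCount_eq h.strictMono s.strictMono ?_⟩
  exact fun m hm => hb ⟨m, Nat.lt_succ_iff.2 hm⟩

end Stable

/-- A diagonal entry contributes equally to its row and to its column. This is why unbounded
diagonal cells do no harm. -/
theorem balanced_congr {m : ℕ} {A B : Matrix (Fin m) (Fin m) ℕ}
    (h : ∀ i j, i ≠ j → A i j = B i j) : Balanced A ↔ Balanced B := by
  refine forall_congr' fun i => ?_
  rw [← Finset.add_sum_erase _ _ (Finset.mem_univ i),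
    ← Finset.add_sum_erase _ (fun j => A j i) (Finset.mem_univ i),
    ← Finset.add_sum_erase _ _ (Finset.mem_univ i),
    ← Finset.add_sum_erase _ (fun j => B j i) (Finset.mem_univ i), add_right_inj, add_right_inj,
    Finset.sum_congr rfl fun j hj => h i j (Finset.ne_of_mem_erase hj).symm,
    Finset.sum_congr rfl fun j hj => h j i (Finset.ne_of_mem_erase hj)]

/-! ### Cycles with large entries -/

theorem exists_walk {V : Type*} {R : V → V → Prop} {a b : V} (h : Relation.ReflTransGen R a b) :
    ∃ (f : ℕ → V) (r : ℕ), f 0 = a ∧ f r = b ∧ ∀ t < r, R (f t) (f (t + 1)) := by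
  induction h with
  | refl => exact ⟨fun _ => a, 0, rfl, rfl, by simp⟩
  | @tail b c _ hbc ih =>
    obtain ⟨f, r, h0, hr, hf⟩ := ih
    refine ⟨Function.update f (r + 1) c, r + 1, by simp [h0], by simp, fun t ht => ?_⟩
    rcases Nat.lt_succ_iff_lt_or_eq.1 ht with ht | rfl
    · rw [Function.update_of_ne (by omega), Function.update_of_ne (by omega)]
      exact hf t ht
    · rw [Function.update_of_ne (by omega), Function.update_self, hr]
      exact hbc

/-- A closed walk for an irreflexive relation contains a simple cycle. -/
theorem exists_simple_cycle {V : Type*} {R : V → V → Prop} (hR : ∀ x, ¬ R x x) {a b : V}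
    (hab : R a b) (h : Relation.ReflTransGen R b a) :
    ∃ r, 2 ≤ r ∧ ∃ i : Fin r → V, Function.Injective i ∧ ∀ t, R (i t) (i (finRotate r t)) := by
  have hex : ∃ r : ℕ, 0 < r ∧ ∃ f : ℕ → V, f 0 = f r ∧ ∀ t < r, R (f t) (f (t + 1)) := by
    obtain ⟨f, r, h0, hr, hf⟩ := exists_walk h
    refine ⟨r + 1, Nat.succ_pos r, Function.update f (r + 1) b, by simp [h0], fun t ht => ?_⟩
    rw [Function.update_of_ne ht.ne]
    rcases Nat.lt_succ_iff_lt_or_eq.1 ht with ht | rfl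
    · rw [Function.update_of_ne (by omega)]
      exact hf t ht
    · rwa [Function.update_self, hr]
  classical
  -- A shortest closed walk repeats no vertex, since a repetition would enclose a shorter closed
  -- walk.
  obtain ⟨hpos, f, h0, hf⟩ := Nat.find_spec hex
  have hmin := fun {r} => Nat.find_min (m := r) hex
  set r := Nat.find hex
  have h2 : 2 ≤ r := by
    by_contra hlt
    have h1 : r = 1 := by omega
    rw [h1] at h0 hf
    have := hf 0 one_pos
    rw [zero_add, ← h0] at this
    exact hR _ this
  have hinj : ∀ s t, s < t → t < r → f s ≠ f t := fun s t hst htr e =>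
    hmin (r := t - s) (by omega) ⟨by omega, fun u => f (s + u), by
      simpa [Nat.add_sub_cancel' hst.le] using e, fun u hu => hf (s + u) (by omega)⟩
  refine ⟨r, h2, fun t => f t, fun s t hst => ?_, fun t => ?_⟩
  · rcases lt_trichotomy s t with h | h | h
    · exact absurd hst (hinj _ _ h t.2)
    · exact h
    · exact absurd hst.symm (hinj _ _ h s.2)
  · have := hf t t.2
    obtain ⟨r', hr'⟩ : ∃ r', r = r' + 1 := ⟨r - 1, by omega⟩
    clear_value r
    subst hr'
    by_cases hl : t = Fin.last r'
    · rw [hl, Fin.val_last, ← h0] at this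
      simpa [hl] using this
    · simpa only [coe_finRotate_of_ne_last hl] using this

/-- Read `A x y` as flow from `x` to `y`. If heavy edges did not lead from `b` back to `a`, let `S`
be the set reached from `b`: only light edges leave `S`, so the outflow is at most `m * m * N`,
while the inflow, which is equal to it, includes `A a b`. -/
theorem exists_heavy_cycle {m : ℕ} {A : Matrix (Fin m) (Fin m) ℕ} (hA : Balanced A) {N : ℕ}
    {a b : Fin m} (hab : a ≠ b) (h : m * m * N < A a b) :
    ∃ r, 2 ≤ r ∧ ∃ i : Fin r → Fin m, Function.Injective i ∧
      ∀ t, N ≤ A (i t) (i (finRotate r t)) := by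
  classical
  let R : Fin m → Fin m → Prop := fun x y => x ≠ y ∧ N ≤ A x y
  have hm : 0 < m := a.pos
  have hRab : R a b := ⟨hab, le_trans (Nat.le_mul_of_pos_left _ (by positivity)) h.le⟩
  have hreach : Relation.ReflTransGen R b a := by
    by_contra hn
    let S := Finset.univ.filter fun x => Relation.ReflTransGen R b x
    have hbS : b ∈ S := by simp [S, Relation.ReflTransGen.refl]
    have haS : a ∈ Sᶜ := by simpa [S] using hn
    have h1 : ∑ x ∈ S, ∑ y, A x y = ∑ x ∈ S, ∑ y, A y x := Finset.sum_congr rfl fun x _ => hA x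
    -- The flow inside `S` occurs on both sides and cancels.
    have h2 : ∑ x ∈ S, ∑ y ∈ Sᶜ, A x y = ∑ x ∈ S, ∑ y ∈ Sᶜ, A y x := by
      simp only [← Finset.sum_add_sum_compl S, Finset.sum_add_distrib] at h1
      rw [Finset.sum_comm (s := S) (t := S)] at h1
      simpa using h1
    have h3 : ∑ x ∈ S, ∑ y ∈ Sᶜ, A x y ≤ ∑ x ∈ S, ∑ y ∈ Sᶜ, N := by
      refine Finset.sum_le_sum fun x hx => Finset.sum_le_sum fun y hy => ?_
      by_contra hlt
      refine Finset.mem_compl.1 hy (Finset.mem_filter.2 ⟨Finset.mem_univ _, ?_⟩)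
      refine (Finset.mem_filter.1 hx).2.tail ⟨?_, (not_le.1 hlt).le⟩
      rintro rfl
      exact Finset.mem_compl.1 hy hx
    have h4 : ∑ x ∈ S, ∑ y ∈ Sᶜ, N ≤ m * m * N := by
      simp only [Finset.sum_const, smul_eq_mul, ← mul_assoc]
      gcongr <;> simpa using Finset.card_le_univ (α := Fin m) _
    have h5 : A a b ≤ ∑ x ∈ S, ∑ y ∈ Sᶜ, A y x :=
      (Finset.single_le_sum (f := fun y => A y b) (fun _ _ => Nat.zero_le _) haS).trans
        (Finset.single_le_sum (f := fun x => ∑ y ∈ Sᶜ, A y x) (fun _ _ => Nat.zero_le _) hbS)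
    omega
  obtain ⟨r, hr, i, hi, h⟩ := exists_simple_cycle (fun x (hx : R x x) => hx.1 rfl) hRab hreach
  exact ⟨r, hr, i, hi, fun t => (h t).2⟩

/-! ### Inflated expansions as patterns -/

/-- The place of `y` relative to the marked points `p l`: even numbers stand for the gaps between
the marked points, odd numbers for the marked points. -/
def place {k : ℕ} {β : Type*} [LinearOrder β] (p : Fin k → β) (y : β) : ℕ :=
  2 * numBelow p y + if ∃ l, p l = y then 1 else 0

section place

variable {k : ℕ} {β : Type*} [LinearOrder β]

theorem place_mono (p : Fin k → β) : Monotone (place p) := by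
  intro y' y h
  rcases h.eq_or_lt with rfl | h
  · exact le_rfl
  have h1 := numBelow_mono p h.le
  unfold place
  split_ifs with h2 h3 h3
  · omega
  · obtain ⟨l, rfl⟩ := h2
    have := numBelow_lt_numBelow h
    omega
  · omega
  · omega

theorem lt_of_place_lt {p : Fin k → β} {x y : β} (h : place p x < place p y) : x < y :=
  lt_of_not_ge fun h' => h.not_ge (place_mono p h')

theorem place_of_unmarked {p : Fin k → β} {y : β} (h : ∀ l, p l ≠ y) :
    place p y = 2 * numBelow p y := by
  simp [place, h]

theorem place_apply (p : Fin k → β) (l : Fin k) : place p (p l) = 2 * numBelow p (p l) + 1 := by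
  simp [place]

theorem numBelow_injOn_range (p : Fin k → β) : Set.InjOn (numBelow p) (Set.range p) := by
  rintro _ ⟨l, rfl⟩ _ ⟨l', rfl⟩ h
  rcases lt_trichotomy (p l) (p l') with h' | h' | h'
  · exact absurd h (numBelow_lt_numBelow h').ne
  · exact h'
  · exact absurd h (numBelow_lt_numBelow h').ne'

/-- `place p` is injective as soon as no two unmarked points are in the same gap. -/
theorem place_injective {p : Fin k → β}
    (h : ∀ x y, (∀ l, p l ≠ x) → (∀ l, p l ≠ y) → numBelow p x = numBelow p y → x = y) :
    Function.Injective (place p) := by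
  intro x y hxy
  by_cases hx : ∃ l, p l = x <;> by_cases hy : ∃ l, p l = y
  · simp only [place, hx, hy, if_true] at hxy
    exact numBelow_injOn_range p hx hy (by omega)
  · simp only [place, hx, hy, if_true, if_false] at hxy
    omega
  · simp only [place, hx, hy, if_true, if_false] at hxy
    omega
  · simp only [place, hx, hy, if_false] at hxy
    exact h x y (not_exists.1 hx) (not_exists.1 hy) (by omega)

end place

theorem isPattern_of_strictMono {π σ : SizedPerm} (f : Fin π.1 → Fin σ.1) (hf : StrictMono f)
    (hv : ∀ x y, π.2 x < π.2 y → σ.2 (f x) < σ.2 (f y)) : IsPattern π σ := by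
  refine ⟨OrderEmbedding.ofStrictMono f hf, fun x y => ⟨hv x y, fun h => ?_⟩⟩
  rcases lt_trichotomy (π.2 x) (π.2 y) with h' | h' | h'
  · exact h'
  · rw [π.2.injective h'] at h
    exact absurd h (lt_irrefl _)
  · exact absurd h (hv _ _ h').not_gt

theorem IsInflation.isPattern {m : ℕ} {α : Perm (Fin m)} {θ : Fin m → SizedPerm}
    {ρ σ : SizedPerm} (h : IsInflation α θ ρ) (G : ∀ j, Fin (θ j).1 → Fin σ.1)
    (hG : ∀ j x y, x < y → G j x < G j y)
    (hGv : ∀ j x y, (θ j).2 x < (θ j).2 y → σ.2 (G j x) < σ.2 (G j y))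
    (hB : ∀ j j' x y, j < j' → G j x < G j' y)
    (hBv : ∀ j j' x y, α j < α j' → σ.2 (G j x) < σ.2 (G j' y)) : IsPattern ρ σ := by
  obtain ⟨e, h1, h2, h3, h4⟩ := h
  have key : ∀ p p', (e p < e p' → G p.1 p.2 < G p'.1 p'.2) ∧
      (ρ.2 (e p) < ρ.2 (e p') → σ.2 (G p.1 p.2) < σ.2 (G p'.1 p'.2)) := by
    rintro ⟨j, x⟩ ⟨j', y⟩
    constructor
    · intro hlt
      rcases lt_trichotomy j j' with h | rfl | h
      · exact hB _ _ _ _ h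
      · exact hG _ _ _ ((h1 _ _ _).1 hlt)
      · exact absurd hlt (h3 _ _ _ _ h).not_gt
    · intro hlt
      rcases lt_trichotomy (α j) (α j') with h | h | h
      · exact hBv _ _ _ _ h
      · obtain rfl := α.injective h
        exact hGv _ _ _ ((h2 _ _ _).1 hlt)
      · exact absurd hlt (h4 _ _ _ _ h).not_gt
  refine isPattern_of_strictMono (fun x => G (e.symm x).1 (e.symm x).2) (fun x y hxy => ?_)
    fun x y hxy => ?_
  · exact (key _ _).1 (by simpa using hxy)
  · exact (key _ _).2 (by simpa using hxy)

section Expansion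

variable {k r : ℕ} {π : Perm (Fin k)} {i : Fin r → Fin (k + 1)} {E : Perm (Fin (k + r))}
  {s : Fin k ↪o Fin (k + r)}

theorem IsExpansion.exists_cell (h : IsExpansion π i E s) {x : Fin (k + r)} (hx : ∀ l, s l ≠ x) :
    ∃ q, numBelow (E ∘ s) (E x) = i q ∧ numBelow s x = i (finRotate r q) := by
  by_contra hn
  have hc := congrFun₂ h.2 ⟨numBelow (E ∘ s) (E x), Nat.lt_succ_iff.2 (numBelow_le _ _)⟩
    ⟨numBelow s x, Nat.lt_succ_iff.2 (numBelow_le _ _)⟩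
  simp only [cycleMatrix, Matrix.of_apply] at hc
  rw [if_neg, cellMatrix, Matrix.of_apply, Finset.card_eq_zero] at hc
  · exact Finset.eq_empty_iff_forall_notMem.1 hc x (by simp [hx, numBelow])
  · rintro ⟨q, h1, h2⟩
    exact hn ⟨q, by rw [h1], by rw [h2]⟩

theorem IsExpansion.eq_of_cell_eq (h : IsExpansion π i E s) {x y : Fin (k + r)}
    (hx : ∀ l, s l ≠ x) (hy : ∀ l, s l ≠ y) (hr : numBelow (E ∘ s) (E x) = numBelow (E ∘ s) (E y))
    (hc : numBelow s x = numBelow s y) : x = y := by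
  have hA := congrFun₂ h.2 ⟨numBelow (E ∘ s) (E x), Nat.lt_succ_iff.2 (numBelow_le _ _)⟩
    ⟨numBelow s x, Nat.lt_succ_iff.2 (numBelow_le _ _)⟩
  have hle : cellMatrix E s ⟨numBelow (E ∘ s) (E x), Nat.lt_succ_iff.2 (numBelow_le _ _)⟩
      ⟨numBelow s x, Nat.lt_succ_iff.2 (numBelow_le _ _)⟩ ≤ 1 := by
    rw [hA, cycleMatrix, Matrix.of_apply]
    split_ifs <;> simp
  rw [cellMatrix, Matrix.of_apply, Finset.card_le_one] at hle
  refine hle x ?_ y ?_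
  · simp [hx, numBelow]
  · simp only [Finset.mem_filter, Finset.mem_univ, true_and]
    exact ⟨hy, hr.symm, hc.symm⟩

/-- Injectivity of `i` leaves at most one entry `1` in each row and each column of the cycle matrix,
so either coordinate alone identifies the cell. -/
theorem IsExpansion.eq_of_numBelow_eq (h : IsExpansion π i E s) (hi : Function.Injective i)
    {x y : Fin (k + r)} (hx : ∀ l, s l ≠ x) (hy : ∀ l, s l ≠ y)
    (hxy : numBelow (E ∘ s) (E x) = numBelow (E ∘ s) (E y) ∨ numBelow s x = numBelow s y) :
    x = y := by
  obtain ⟨q, h1, h2⟩ := h.exists_cell hx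
  obtain ⟨q', h1', h2'⟩ := h.exists_cell hy
  have hq : q = q' := by
    rcases hxy with hxy | hxy
    · exact hi (Fin.ext (by rw [← h1, hxy, h1']))
    · exact (finRotate r).injective (hi (Fin.ext (by rw [← h2, hxy, h2'])))
  subst hq
  exact h.eq_of_cell_eq hx hy (by rw [h1, h1']) (by rw [h2, h2'])

theorem IsExpansion.place_injective (h : IsExpansion π i E s) (hi : Function.Injective i) :
    Function.Injective (place s) :=
  TOTO.place_injective fun _ _ hx hy hxy => h.eq_of_numBelow_eq hi hx hy (.inr hxy)

theorem IsExpansion.place_val_injective (h : IsExpansion π i E s) (hi : Function.Injective i) :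
    Function.Injective (place (E ∘ s)) := by
  refine TOTO.place_injective fun x y hx hy hxy => ?_
  rw [← E.apply_symm_apply x, ← E.apply_symm_apply y] at hxy
  have := h.eq_of_numBelow_eq hi (x := E.symm x) (y := E.symm y)
    (fun l hl => hx l (by simp [hl])) (fun l hl => hy l (by simp [hl])) (.inl hxy)
  simpa using this

/-- The unmarked points of an expansion, from left to right, lie in the columns of `i`, from left
to right. -/
theorem IsExpansion.numBelow_unmarked (h : IsExpansion π i E s) (hi : Function.Injective i)
    {u : Fin r ↪o Fin (k + r)} (hu : Set.range u = (Set.range s)ᶜ) {c : Fin r ↪o Fin (k + 1)}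
    (hc : Set.range c = Set.range i) (t : Fin r) : numBelow s (u t) = c t := by
  have hun : ∀ t l, s l ≠ u t := fun t l hl =>
    (hu ▸ Set.mem_range_self t : u t ∈ (Set.range s)ᶜ) ⟨l, hl⟩
  let f : Fin r → Fin (k + 1) := fun t => ⟨numBelow s (u t), Nat.lt_succ_iff.2 (numBelow_le _ _)⟩
  have hfi : Function.Injective f := fun t t' htt' =>
    u.injective (h.eq_of_numBelow_eq hi (hun t) (hun t') (.inr (congrArg Fin.val htt')))
  have hfm : Monotone f := fun t t' htt' => numBelow_mono s (u.monotone htt')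
  have hsub : Set.range f ⊆ Set.range i := by
    rintro _ ⟨t, rfl⟩
    obtain ⟨q, -, h2⟩ := h.exists_cell (hun t)
    exact ⟨_, Fin.ext h2.symm⟩
  have heq : Set.range f = Set.range i := by
    refine Set.eq_of_subset_of_ncard_le hsub ?_
    rw [Set.ncard_range_of_injective hi, Set.ncard_range_of_injective hfi]
  have := (StrictMono.range_inj (hfm.strictMono_of_injective hfi) c.strictMono).1 (heq.trans hc.symm)
  exact congrArg Fin.val (congrFun this t)

/-- The class of increasing or of decreasing permutations. -/
def monoClass (b : Bool) : Set SizedPerm := if b then incClass else decClass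

/-- Each block goes to points of `σ` having the same `place` in both coordinates. Distinct points of
the expansion have distinct places, so the order between blocks is automatic, and inside a block the
monotone sequence `f q` supplies it. Directions `b` are indexed by columns because `Θ` runs from
left to right whereas `f` follows the cycle. -/
theorem IsInflatedExpansion.isPattern {n N : ℕ} {σ : Perm (Fin n)} {s : Fin k ↪o Fin n}
    (hs : IsOccurrence π σ s) (hi : Function.Injective i) {c : Fin r ↪o Fin (k + 1)}
    (hc : Set.range c = Set.range i) (b : Fin (k + 1) → Bool) (f : Fin r → Fin N → Fin n)
    (hf : ∀ q, StrictMono (f q))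
    (hfv : ∀ q, if b (i (finRotate r q)) then StrictMono (σ ∘ f q) else StrictAnti (σ ∘ f q))
    (hfu : ∀ q x l, s l ≠ f q x) (hfr : ∀ q x, numBelow (σ ∘ s) (σ (f q x)) = i q)
    (hfc : ∀ q x, numBelow s (f q x) = i (finRotate r q))
    {Θ : Fin r → SizedPerm} {ρ : SizedPerm} (hρ : IsInflatedExpansion π i Θ ρ)
    (hΘ : ∀ t, Θ t ∈ monoClass (b (c t))) (hN : ∀ t, (Θ t).1 ≤ N) : IsPattern ρ ⟨n, σ⟩ := by
  obtain ⟨E, s', u, θ, hE, hu, hθs, hθu, hinf⟩ := hρ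
  have hun : ∀ t l, s' l ≠ u t := fun t l hl =>
    (hu ▸ Set.mem_range_self t : u t ∈ (Set.range s')ᶜ) ⟨l, hl⟩
  have hvs : ∀ {m : ℕ} {τ : Perm (Fin m)} {z : Fin k ↪o Fin m}, IsOccurrence π τ z → ∀ l,
      numBelow (τ ∘ z) ((τ ∘ z) l) = π l := by
    intro m τ z hz l
    have h1 := numBelow_apply hz.strictMono (π l)
    have h2 : (fun l => τ (z (π.symm l))) = (τ ∘ z) ∘ π.symm := rfl
    rw [h2, numBelow_comp_perm] at h1
    simpa using h1
  have hex : ∀ j, ∃ G : Fin (θ j).1 → Fin n, (∀ x y, x < y → G x < G y) ∧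
      (∀ x y, (θ j).2 x < (θ j).2 y → σ (G x) < σ (G y)) ∧
      (∀ x, place s (G x) = place s' j) ∧
      ∀ x, place (σ ∘ s) (σ (G x)) = place (E ∘ s') (E j) := by
    intro j
    by_cases hj : j ∈ Set.range s'
    · obtain ⟨l, rfl⟩ := hj
      rw [hθs l]
      refine ⟨fun _ => s l, fun x y hxy => ?_, fun x y hxy => ?_, fun _ => ?_, fun _ => ?_⟩
      · exact absurd hxy (by simp [Subsingleton.elim x y])
      · exact absurd hxy (by simp [Subsingleton.elim x y])
      · rw [place_apply, place_apply, numBelow_apply s.strictMono, numBelow_apply s'.strictMono]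
      · have h1 := place_apply (σ ∘ s) l
        have h2 := place_apply (E ∘ s') l
        rw [hvs hs] at h1
        rw [hvs hE.1.1] at h2
        exact h1.trans h2.symm
    · rw [← Set.mem_compl_iff, ← hu] at hj
      obtain ⟨t, rfl⟩ := hj
      obtain ⟨q, hq1, hq2⟩ := hE.exists_cell (hun t)
      have hcq : i (finRotate r q) = c t :=
        Fin.ext (by rw [← hq2, hE.numBelow_unmarked hi hu hc t])
      have hm := hΘ t
      have hv := hfv q
      have hn := hN t
      rw [hθu t]
      rw [← hcq] at hm
      refine ⟨fun x => f q (Fin.castLE hn x), fun x y hxy => hf q (by simpa using hxy),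
        fun x y hxy => ?_, fun x => ?_, fun x => ?_⟩
      · cases hb : b (i (finRotate r q))
        · simp only [hb, monoClass, Bool.false_eq_true, if_false, decClass] at hm hv
          refine hv ?_
          have hm' : StrictAnti (Θ t).2 := hm
          simpa using hm'.lt_iff_gt.1 hxy
        · simp only [hb, monoClass, if_true, incClass] at hm hv
          refine hv ?_
          have hm' : StrictMono (Θ t).2 := hm
          simpa using hm'.lt_iff_lt.1 hxy
      · rw [place_of_unmarked (hfu q _), place_of_unmarked (hun t), hfc, hq2]
      · rw [place_of_unmarked (p := σ ∘ s) fun l hl => hfu q _ l (σ.injective hl),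
          place_of_unmarked (p := E ∘ s') fun l hl => hun t l (E.injective hl), hfr, hq1]
  choose G hG hGv hGp hGpv using hex
  refine hinf.isPattern G hG hGv (fun j j' x y hjj => lt_of_place_lt (p := s) ?_)
    (fun j j' x y hjj => lt_of_place_lt (p := σ ∘ s) ?_)
  · rw [hGp, hGp]
    exact ((place_mono _).strictMono_of_injective (hE.place_injective hi)) hjj
  · simp only [hGpv]
    exact ((place_mono _).strictMono_of_injective (hE.place_val_injective hi)) hjj

end Expansion

/-! ### Defining stable occurrences -/

/-- A bound that is uniform over the finitely many pairs of a cycle and a sequence of classes. -/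
theorem AvoidsSomeInEach.exists_bound {C : Set SizedPerm} (hC : IsPermClass C) {k : ℕ}
    {π : Perm (Fin k)} (h : AvoidsSomeInEach C π) :
    ∃ N : ℕ, ∀ r, 2 ≤ r → ∀ i : Fin r → Fin (k + 1), Function.Injective i → ∀ b : Fin r → Bool,
      ∃ (Θ : Fin r → SizedPerm) (ρ : SizedPerm), (∀ t, Θ t ∈ monoClass (b t)) ∧
        IsInflatedExpansion π i Θ ρ ∧ ρ ∉ C ∧ ∀ t, (Θ t).1 ≤ N := by
  have key : ∀ᶠ N in Filter.atTop, ∀ (r : Fin (k + 2)) (i : Fin r → Fin (k + 1))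
      (b : Fin r → Bool), 2 ≤ r.val → Function.Injective i →
      ∃ (Θ : Fin r → SizedPerm) (ρ : SizedPerm), (∀ t, Θ t ∈ monoClass (b t)) ∧
        IsInflatedExpansion π i Θ ρ ∧ ρ ∉ C ∧ ∀ t, (Θ t).1 ≤ N := by
    simp only [Filter.eventually_all]
    intro r i b hr hi
    obtain ⟨τ, ⟨Θ, ρ, hΘ, hρ, hτ⟩, hτC⟩ := h r hr i hi (fun t => monoClass (b t)) fun t => by
      cases b t <;> simp [monoClass]
    filter_upwards [Filter.eventually_ge_atTop (∑ t, (Θ t).1)] with N hN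
    exact ⟨Θ, ρ, hΘ, hρ, fun hρC => hτC (hC ρ hρC τ hτ), fun t =>
      (Finset.single_le_sum (f := fun t => (Θ t).1) (fun _ _ => Nat.zero_le _)
        (Finset.mem_univ t)).trans hN⟩
  obtain ⟨N, hN⟩ := key.exists
  refine ⟨N, fun r hr i hi b => ?_⟩
  have hrk : r ≤ k + 1 := by simpa using Fintype.card_le_of_injective i hi
  exact hN ⟨r, by omega⟩ i b hr hi

theorem AvoidsSomeInEach.exists_entry_bound {C : Set SizedPerm} (hC : IsPermClass C) {k : ℕ}
    {π : Perm (Fin k)} (h : AvoidsSomeInEach C π) :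
    ∃ B : ℕ, ∀ n (σ : Perm (Fin n)), (⟨n, σ⟩ : SizedPerm) ∈ C → ∀ s : Fin k ↪o Fin n,
      IsStableOccurrence π σ s → ∀ x y, x ≠ y → cellMatrix σ s x y ≤ B := by
  obtain ⟨N, hN⟩ := h.exists_bound hC
  -- `2 ^ (N + N)` points guarantee a monotone subset of size `N`; the other factor is the loss in
  -- `exists_heavy_cycle`.
  refine ⟨(k + 1) * (k + 1) * 2 ^ (N + N), fun n σ hσ s hs x y hxy => ?_⟩
  by_contra hlt
  obtain ⟨r, hr, i, hi, hheavy⟩ :=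
    exists_heavy_cycle (hs.1.stable_iff_balanced.1 hs) hxy (not_le.1 hlt)
  have hex : ∀ q, ∃ (v : Bool) (f : Fin N → Fin n), StrictMono f ∧
      (if v then StrictMono (σ ∘ f) else StrictAnti (σ ∘ f)) ∧ ∀ x, (∀ l, s l ≠ f x) ∧
        numBelow (σ ∘ s) (σ (f x)) = i q ∧ numBelow s (f x) = i (finRotate r q) := by
    intro q
    have hmem : ∀ T : Finset (Fin n), ∀ hT : T.card = N, ∀ x, T.orderEmbOfFin hT x ∈ T :=
      fun T hT x => T.orderEmbOfFin_mem hT x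
    have hcell : 2 ^ (N + N) ≤ (Finset.univ.filter fun x => (∀ l, s l ≠ x) ∧
        numBelow (σ ∘ s) (σ x) = i q ∧ numBelow s x = i (finRotate r q)).card := by
      simpa [cellMatrix, numBelow] using hheavy q
    rcases exists_monotone_subset σ σ.injective N N _ hcell with
      ⟨T, hTs, hT, hm⟩ | ⟨T, hTs, hT, hm⟩
    · exact ⟨true, T.orderEmbOfFin hT, (T.orderEmbOfFin hT).strictMono,
        fun x y hxy => hm (hmem T hT x) (hmem T hT y) ((T.orderEmbOfFin hT).strictMono hxy),
        fun x => (Finset.mem_filter.1 (hTs (hmem T hT x))).2⟩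
    · exact ⟨false, T.orderEmbOfFin hT, (T.orderEmbOfFin hT).strictMono,
        fun x y hxy => hm (hmem T hT x) (hmem T hT y) ((T.orderEmbOfFin hT).strictMono hxy),
        fun x => (Finset.mem_filter.1 (hTs (hmem T hT x))).2⟩
  choose v f hf hfv hfx using hex
  have hcard : (Finset.univ.image i).card = r := by
    rw [Finset.card_image_of_injective _ hi, Finset.card_univ, Fintype.card_fin]
  let c := (Finset.univ.image i).orderEmbOfFin hcard
  have hc : Set.range c = Set.range i := by simp [c]
  -- Transfers the directions found in the cells from cycle order to columns; each column of the
  -- cycle belongs to one `q` only.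
  let b : Fin (k + 1) → Bool := fun z => decide (∃ q, i (finRotate r q) = z ∧ v q = true)
  have hb : ∀ q, b (i (finRotate r q)) = v q := by
    intro q
    rw [Bool.eq_iff_iff, decide_eq_true_iff]
    refine ⟨?_, fun hq => ⟨q, rfl, hq⟩⟩
    rintro ⟨q', h1, h2⟩
    rwa [← (finRotate r).injective (hi h1)]
  obtain ⟨Θ, ρ, hΘ, hρ, hρC, hle⟩ := hN r hr i hi fun t => b (c t)
  refine hρC (hC _ hσ _ (hρ.isPattern hs.1 hi hc b f hf (fun q => ?_) (fun q x => (hfx q x).1)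
    (fun q x => (hfx q x).2.1) (fun q x => (hfx q x).2.2) hΘ hle))
  rw [hb]
  exact hfv q

/-- A finite disjunction over the possible sets `S` of marked indices below `y`. -/
theorem Definable.numBelow_eq {α : Type} {k : ℕ} (p : Fin k → α) (y : α) (m : ℕ) :
    Definable fun _ _ (a : α → _) => numBelow (a ∘ p) (a y) = m := by
  obtain ⟨φ, hφ⟩ := Definable.exists_finite (α := α) (β := Finset (Fin k)) fun S =>
    (Definable.const (S.card = m)).and (Definable.forall_finite fun l =>
      (Definable.const (l ∈ S)).iff (Definable.posLT (p l) y))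
  refine ⟨φ, fun n σ a => (hφ n σ a).trans ⟨?_, fun h => ⟨_, h, by simp⟩⟩⟩
  rintro ⟨S, rfl, hS⟩
  unfold numBelow
  congr 1
  ext l
  simp [hS]

theorem Definable.numBelow_val_eq {α : Type} {k : ℕ} (p : Fin k → α) (y : α) (m : ℕ) :
    Definable fun _ σ (a : α → _) => numBelow (σ ∘ a ∘ p) (σ (a y)) = m := by
  obtain ⟨φ, hφ⟩ := Definable.exists_finite (α := α) (β := Finset (Fin k)) fun S =>
    (Definable.const (S.card = m)).and (Definable.forall_finite fun l =>
      (Definable.const (l ∈ S)).iff (Definable.valLT (p l) y))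
  refine ⟨φ, fun n σ a => (hφ n σ a).trans ⟨?_, fun h => ⟨_, h, by simp⟩⟩⟩
  rintro ⟨S, rfl, hS⟩
  unfold numBelow
  congr 1
  ext l
  simp [hS]

theorem Definable.cellMatrix_eq (k : ℕ) (x y : Fin (k + 1)) (m : ℕ) :
    ∃ φ : lang.Formula (Fin k), ∀ n (σ : Perm (Fin n)) (s : Fin k ↪o Fin n),
      Satisfies σ s φ ↔ cellMatrix σ s x y = m := by
  have h : Definable fun _ σ (a : Fin k ⊕ Unit → _) =>
      (∀ l, ¬ a (.inl l) = a (.inr ())) ∧ numBelow (σ ∘ a ∘ Sum.inl) (σ (a (.inr ()))) = x ∧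
        numBelow (a ∘ Sum.inl) (a (.inr ())) = y :=
    (Definable.forall_finite fun l => (Definable.eq _ _).not).and
      ((Definable.numBelow_val_eq _ _ _).and (Definable.numBelow_eq _ _ _))
  obtain ⟨φ, hφ⟩ := h.card_eq m
  refine ⟨φ, fun n σ s => (hφ n σ s).trans ?_⟩
  rw [cellMatrix, Matrix.of_apply, ← Nat.subtype_card _ fun x => Finset.mem_filter_univ x]
  exact Iff.rfl

/-- With off-diagonal entries bounded by `B` and the diagonal irrelevant, finitely many balanced
matrices cover all stable occurrences in `C`. -/
theorem AvoidsSomeInEach.exists_formula {C : Set SizedPerm} (hC : IsPermClass C) {k : ℕ}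
    {π : Perm (Fin k)} (h : AvoidsSomeInEach C π) :
    ∃ φ : lang.Formula (Fin k), ∀ σ ∈ C, ∀ a : Fin k → Fin σ.1,
      Satisfies σ.2 a φ ↔ ∃ s : Fin k ↪o Fin σ.1, IsStableOccurrence π σ.2 s ∧ a = s := by
  obtain ⟨B, hB⟩ := h.exists_entry_bound hC
  choose ψ hψ using fun x y => Definable.cellMatrix_eq k x y
  obtain ⟨φ, hφ⟩ :
      Definable fun n σ (a : Fin k → Fin n) => ((∀ j h : Fin k, j < h → a j < a h) ∧
        ∀ j h : Fin k, π j < π h ↔ σ (a j) < σ (a h)) ∧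
        ∃ A : Fin (k + 1) → Fin (k + 1) → Fin (B + 1), Balanced (.of fun x y => (A x y : ℕ)) ∧
          ∀ x y, x ≠ y → Satisfies σ a (ψ x y (A x y)) :=
    ((Definable.forall_finite fun j => .forall_finite fun h =>
        (Definable.const _).imp (Definable.posLT j h)).and
      (.forall_finite fun j => .forall_finite fun h =>
        (Definable.const _).iff (Definable.valLT j h))).and
      (.exists_finite fun A => (Definable.const _).and
        (.forall_finite fun x => .forall_finite fun y => (Definable.const _).imp
          ⟨ψ x y (A x y), fun _ _ _ => Iff.rfl⟩))
  refine ⟨φ, fun ⟨n, σ⟩ hσ a => (hφ n σ a).trans ⟨?_, ?_⟩⟩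
  · rintro ⟨⟨h1, h2⟩, A, hA, hcell⟩
    let s := OrderEmbedding.ofStrictMono a h1
    have hs : IsOccurrence π σ s := h2
    refine ⟨s, hs.stable_iff_balanced.2 ((balanced_congr fun x y hxy => ?_).1 hA), rfl⟩
    exact ((hψ x y _ n σ s).1 (hcell x y hxy)).symm
  · rintro ⟨s, hs, rfl⟩
    refine ⟨⟨fun _ _ hjh => s.strictMono hjh, hs.1⟩,
      -- Diagonal entries may exceed `B`, so they are replaced by `0`, which does not affect
      -- balance.
      fun x y => ⟨if x = y then 0 else cellMatrix σ s x y, ?_⟩, ?_, fun x y hxy => ?_⟩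
    · split_ifs with hxy
      · omega
      · exact Nat.lt_succ_iff.2 (hB n σ hσ s hs x y hxy)
    · refine (balanced_congr fun x y hxy => ?_).1 (hs.1.stable_iff_balanced.1 hs)
      simp [hxy]
    · exact (hψ x y _ n σ s).2 (by simp [hxy])

/-- Stable occurrences listed in prescribed orders are definable. -/
theorem exists_formula_of_forall_avoids {C : Set SizedPerm} (hC : IsPermClass C) {k : ℕ}
    (Q : Perm (Fin k) → Perm (Fin k) → Prop) (hQ : ∀ π e, Q π e → AvoidsSomeInEach C π) :
    ∃ φ : lang.Formula (Fin k), ∀ σ ∈ C, ∀ a : Fin k → Fin σ.1,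
      Satisfies σ.2 a φ ↔ ∃ π e, Q π e ∧ ∃ s : Fin k ↪o Fin σ.1,
        IsStableOccurrence π σ.2 s ∧ a = s ∘ e := by
  have hex : ∀ π e, ∃ φ : lang.Formula (Fin k), Q π e → ∀ σ ∈ C, ∀ a : Fin k → Fin σ.1,
      Satisfies σ.2 a φ ↔ ∃ s : Fin k ↪o Fin σ.1, IsStableOccurrence π σ.2 s ∧ a = s := by
    intro π e
    by_cases h : Q π e
    · obtain ⟨φ, hφ⟩ := (hQ π e h).exists_formula hC
      exact ⟨φ, fun _ => hφ⟩
    · exact ⟨⊥, fun h' => absurd h' h⟩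
  choose φ hφ using hex
  obtain ⟨χ, hχ⟩ : Definable fun n σ (a : Fin k → Fin n) =>
      ∃ π e, Q π e ∧ Satisfies σ (a ∘ e.symm) (φ π e) :=
    .exists_finite fun π => .exists_finite fun e => (Definable.const _).and
      (Definable.relabel (P := fun n σ a => Satisfies σ a (φ π e))
        ⟨φ π e, fun _ _ _ => Iff.rfl⟩ e.symm)
  refine ⟨χ, fun σ hσ a => (hχ _ _ _).trans ?_⟩
  refine exists_congr fun π => exists_congr fun e => and_congr_right fun hq => ?_
  rw [hφ π e hq σ hσ]
  refine exists_congr fun s => and_congr_right fun _ => ?_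
  constructor
  · intro h
    rw [← h]
    funext x
    simp
  · rintro rfl
    funext x
    simp

/-! ### Existence of expansions and inflations -/

theorem exists_orderEquiv {α β : Type*} [Fintype α] [LinearOrder β] {n : ℕ}
    (hn : Fintype.card α = n) {f : α → β} (hf : Function.Injective f) :
    ∃ o : α ≃ Fin n, ∀ x y, o x < o y ↔ f x < f y := by
  let _ : LinearOrder α := LinearOrder.lift' f hf
  exact ⟨(Fintype.orderIsoFinOfCardEq α hn).symm.toEquiv,
    fun x y => (Fintype.orderIsoFinOfCardEq α hn).symm.lt_iff_lt⟩

theorem exists_isExpansion {k r : ℕ} (π : Perm (Fin k)) {i : Fin r → Fin (k + 1)}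
    (hi : Function.Injective i) :
    ∃ (E : Perm (Fin (k + r))) (s : Fin k ↪o Fin (k + r)), IsExpansion π i E s := by
  obtain ⟨o, ho⟩ := exists_orderEquiv (α := Fin k ⊕ Fin r) (n := k + r) (by simp)
    (f := Sum.elim (fun l => 2 * (l : ℕ) + 1) fun t => 2 * (i t : ℕ)) (by
      rintro (l | t) (l' | t') h <;> simp only [Sum.elim_inl, Sum.elim_inr] at h
      · rw [Fin.ext (a := l) (b := l') (by omega)]
      · omega
      · omega
      · rw [hi (Fin.ext (a := i t) (b := i t') (by omega))])
  let s : Fin k ↪o Fin (k + r) := OrderEmbedding.ofStrictMono (fun l => o (.inl l)) fun l l' h => by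
    rw [ho]
    simpa using h
  -- Rows record values and columns positions, so the new point in the column `i t` must take its
  -- value in the gap preceding `i t` in the cycle; hence the inverse rotation.
  let E : Perm (Fin (k + r)) := o.symm.trans ((sumCongr π (finRotate r).symm).trans o)
  have hs : ∀ l, s l = o (.inl l) := fun _ => rfl
  have hEs : ∀ l, E (s l) = s (π l) := fun l => by simp [E, hs]
  have hEu : ∀ t, E (o (.inr t)) = o (.inr ((finRotate r).symm t)) := fun t => by simp [E]
  have hocc : IsOccurrence π E s := fun j h => by rw [hEs, hEs, s.lt_iff_lt]
  have hcol : ∀ t, numBelow s (o (.inr t)) = i t := by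
    intro t
    simp only [numBelow, hs, ho, Sum.elim_inl, Sum.elim_inr]
    have hlt : ∀ l : Fin k, 2 * (l : ℕ) + 1 < 2 * (i t : ℕ) ↔ (l : ℕ) < i t := fun l => by omega
    simp only [hlt]
    rw [Fin.card_filter_val_lt, min_eq_right (Nat.lt_succ_iff.1 (i t).2)]
  have hrow : ∀ x, numBelow (E ∘ s) x = numBelow s x := fun x => by
    rw [show E ∘ s = s ∘ π from funext hEs, numBelow_comp_perm]
  refine ⟨E, s, ⟨hocc, hocc.stable_iff_apply.2 hEs |>.2⟩, ?_⟩
  ext a b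
  have hmem : ∀ x, ((∀ l, s l ≠ x) ∧ numBelow (E ∘ s) (E x) = a ∧ numBelow s x = b) ↔
      ∃ t, i t = a ∧ i (finRotate r t) = b ∧ o (.inr (finRotate r t)) = x := by
    intro x
    constructor
    · rintro ⟨h1, h2, h3⟩
      obtain ⟨t | t, rfl⟩ := o.surjective x
      · exact absurd rfl (h1 t)
      · rw [hEu, hrow, hcol] at h2
        rw [hcol] at h3
        exact ⟨(finRotate r).symm t, Fin.ext h2, by rw [apply_symm_apply, Fin.ext h3],
          by rw [apply_symm_apply]⟩
    · rintro ⟨t, rfl, rfl, rfl⟩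
      refine ⟨fun l hl => by simp [hs] at hl, ?_, hcol _⟩
      rw [hEu, hrow, hcol, symm_apply_apply]
  rw [cycleMatrix, Matrix.of_apply]
  have hcard : cellMatrix E s a b = (Finset.univ.filter fun x => ∃ t, i t = a ∧
      i (finRotate r t) = b ∧ o (.inr (finRotate r t)) = x).card := by
    rw [cellMatrix, Matrix.of_apply]
    congr 1
    ext x
    simp only [Finset.mem_filter, Finset.mem_univ, true_and, ← hmem]
    rfl
  rw [hcard]
  split_ifs with h
  · obtain ⟨t, ha, hb⟩ := h
    rw [Finset.card_eq_one]
    refine ⟨o (.inr (finRotate r t)), ?_⟩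
    ext x
    simp only [Finset.mem_filter, Finset.mem_univ, true_and, Finset.mem_singleton]
    refine ⟨?_, fun hx => ⟨t, ha, hb, hx.symm⟩⟩
    rintro ⟨t', ha', -, rfl⟩
    rw [hi (ha'.trans ha.symm)]
  · rw [Finset.card_eq_zero, Finset.filter_eq_empty_iff]
    rintro x - ⟨t, ha, hb, -⟩
    exact h ⟨t, ha, hb⟩

/-- `e` matches the points of the blocks of an inflation with the points of `ρ`. -/
def IsInflationEquiv {n : ℕ} (α : Perm (Fin n)) (θ : Fin n → SizedPerm) (ρ : SizedPerm)
    (e : (Σ j : Fin n, Fin (θ j).1) ≃ Fin ρ.1) : Prop :=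
  (∀ j x y, e ⟨j, x⟩ < e ⟨j, y⟩ ↔ x < y) ∧
  (∀ j x y, ρ.2 (e ⟨j, x⟩) < ρ.2 (e ⟨j, y⟩) ↔ (θ j).2 x < (θ j).2 y) ∧
  (∀ j j' x y, j < j' → e ⟨j, x⟩ < e ⟨j', y⟩) ∧
  (∀ j j' x y, α j < α j' → ρ.2 (e ⟨j, x⟩) < ρ.2 (e ⟨j', y⟩))

/-- Positions and values are the ranks of the points in two lexicographic orders, block first. -/
theorem exists_isInflationEquiv {n : ℕ} (α : Perm (Fin n)) (θ : Fin n → SizedPerm) :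
    ∃ ρ e, IsInflationEquiv α θ ρ e := by
  have hinj : ∀ τ : ∀ j, Perm (Fin (θ j).1), ∀ β : Perm (Fin n), Function.Injective
      fun p : Σ j : Fin n, Fin (θ j).1 => toLex ((β p.1 : ℕ), (τ p.1 p.2 : ℕ)) := by
    rintro τ β ⟨j, x⟩ ⟨j', y⟩ h
    simp only [EmbeddingLike.apply_eq_iff_eq, Prod.mk.injEq] at h
    obtain rfl := β.injective (Fin.ext h.1)
    rw [(τ j).injective (Fin.ext h.2)]
  obtain ⟨o, ho⟩ := exists_orderEquiv rfl (hinj (fun _ => 1) 1)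
  obtain ⟨o', ho'⟩ := exists_orderEquiv rfl (hinj (fun j => (θ j).2) α)
  refine ⟨⟨_, o.symm.trans o'⟩, o, ?_, ?_, ?_, ?_⟩
  · intro j x y
    rw [ho]
    simp [Prod.Lex.toLex_lt_toLex]
  · intro j x y
    simp [ho', Prod.Lex.toLex_lt_toLex]
  · intro j j' x y h
    rw [ho]
    simp [Prod.Lex.toLex_lt_toLex, h]
  · intro j j' x y h
    simp [ho', Prod.Lex.toLex_lt_toLex, h]

namespace IsInflationEquiv

variable {n : ℕ} {α : Perm (Fin n)} {θ : Fin n → SizedPerm} {ρ : SizedPerm}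
  {e : (Σ j : Fin n, Fin (θ j).1) ≃ Fin ρ.1}

theorem lt_iff (h : IsInflationEquiv α θ ρ e) {j j' : Fin n} (x : Fin (θ j).1) (y : Fin (θ j').1)
    (hy : (θ j').1 = 1) : e ⟨j, x⟩ < e ⟨j', y⟩ ↔ j < j' := by
  refine ⟨fun hlt => ?_, h.2.2.1 _ _ _ _⟩
  rcases lt_trichotomy j j' with h' | rfl | h'
  · exact h'
  · have := (h.1 _ _ _).1 hlt
    omega
  · exact absurd hlt (h.2.2.1 _ _ _ _ h').not_gt

theorem val_lt_iff (h : IsInflationEquiv α θ ρ e) {j j' : Fin n} (x : Fin (θ j).1)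
    (y : Fin (θ j').1) (hy : (θ j').1 = 1) :
    ρ.2 (e ⟨j, x⟩) < ρ.2 (e ⟨j', y⟩) ↔ α j < α j' := by
  refine ⟨fun hlt => ?_, h.2.2.2 _ _ _ _⟩
  rcases lt_trichotomy (α j) (α j') with h' | h' | h'
  · exact h'
  · obtain rfl := α.injective h'
    have := (h.2.1 _ _ _).1 hlt
    omega
  · exact absurd hlt (h.2.2.2 _ _ _ _ h').not_gt

/-- The position of a singleton block. -/
theorem val_apply (h : IsInflationEquiv α θ ρ e) {j : Fin n} (x : Fin (θ j).1)
    (hx : (θ j).1 = 1) : (e ⟨j, x⟩ : ℕ) = ∑ j' with j' < j, (θ j').1 := by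
  have h1 : (e ⟨j, x⟩ : ℕ) = (Finset.univ.filter fun p => e p < e ⟨j, x⟩).card := by
    rw [← Fin.card_Iio (e ⟨j, x⟩)]
    exact (Finset.card_equiv e (by simp)).symm
  have h2 : (Finset.univ.filter fun p => e p < e ⟨j, x⟩) =
      (Finset.univ.filter fun j' => j' < j).sigma fun _ => Finset.univ := by
    ext ⟨j', y⟩
    simp [h.lt_iff y x hx]
  rw [h1, h2, Finset.card_sigma]
  simp

/-- The value of a singleton block. -/
theorem val_perm_apply (h : IsInflationEquiv α θ ρ e) {j : Fin n} (x : Fin (θ j).1)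
    (hx : (θ j).1 = 1) : (ρ.2 (e ⟨j, x⟩) : ℕ) = ∑ j' with α j' < α j, (θ j').1 := by
  have h1 : (ρ.2 (e ⟨j, x⟩) : ℕ) =
      (Finset.univ.filter fun p => ρ.2 (e p) < ρ.2 (e ⟨j, x⟩)).card := by
    rw [← Fin.card_Iio (ρ.2 (e ⟨j, x⟩))]
    exact (Finset.card_equiv (e.trans ρ.2) (by simp)).symm
  have h2 : (Finset.univ.filter fun p => ρ.2 (e p) < ρ.2 (e ⟨j, x⟩)) =
      (Finset.univ.filter fun j' => α j' < α j).sigma fun _ => Finset.univ := by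
    ext ⟨j', y⟩
    simp [h.val_lt_iff y x hx]
  rw [h1, h2, Finset.card_sigma]
  simp

variable {k : ℕ} {π : Perm (Fin k)} {s : Fin k ↪o Fin n}

theorem zero_lt_size (hθ : ∀ l, (θ (s l)).1 = 1) (l : Fin k) : 0 < (θ (s l)).1 := by simp [hθ]

/-- The marked points of an inflation in which the marked points are kept. -/
def marked (h : IsInflationEquiv α θ ρ e) (hθ : ∀ l, (θ (s l)).1 = 1) : Fin k ↪o Fin ρ.1 :=
  OrderEmbedding.ofStrictMono (fun l => e ⟨s l, ⟨0, zero_lt_size hθ l⟩⟩)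
    fun _ _ hl => h.2.2.1 _ _ _ _ (s.strictMono hl)

theorem isOccurrence_marked (h : IsInflationEquiv α θ ρ e) (hθ : ∀ l, (θ (s l)).1 = 1)
    (hs : IsOccurrence π α s) : IsOccurrence π ρ.2 (h.marked hθ) := fun j j' =>
  (hs j j').trans (h.val_lt_iff _ _ (hθ j')).symm

/-- Marked points are singleton blocks, so their positions and values are total sizes of the blocks
to their left and below them. -/
theorem isStableOccurrence_marked_iff (h : IsInflationEquiv α θ ρ e)
    (hθ : ∀ l, (θ (s l)).1 = 1) (hs : IsStableOccurrence π α s) :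
    IsStableOccurrence π ρ.2 (h.marked hθ) ↔
      ∀ l, ∑ j with α j < s l, (θ j).1 = ∑ j with j < s l, (θ j).1 := by
  rw [(h.isOccurrence_marked hθ hs.1).stable_iff_apply, π.forall_congr_left]
  refine forall_congr' fun l => ?_
  have h1 := h.val_perm_apply ⟨0, zero_lt_size hθ (π.symm l)⟩ (hθ _)
  have h2 := h.val_apply ⟨0, zero_lt_size hθ l⟩ (hθ _)
  rw [hs.1.stable_iff_apply.1 hs, apply_symm_apply] at h1
  rw [← h1, ← h2, apply_symm_apply, ← Fin.ext_iff]
  rfl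

end IsInflationEquiv

/-! ### Inflating one point by one more point -/

/-- The increasing or the decreasing permutation. -/
def monoPerm (b : Bool) (n : ℕ) : Perm (Fin n) := if b then 1 else Fin.revPerm

theorem monoPerm_lt_monoPerm {b : Bool} {n n' : ℕ} {f : Fin n → Fin n'} (hf : StrictMono f)
    {x y : Fin n} (h : monoPerm b n x < monoPerm b n y) :
    monoPerm b n' (f x) < monoPerm b n' (f y) := by
  cases b
  · simp only [monoPerm, Bool.false_eq_true, if_false, Fin.revPerm_apply, Fin.rev_lt_rev] at h ⊢
    exact hf h
  · simp only [monoPerm, if_true, Perm.one_apply] at h ⊢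
    exact hf h

/-- A map that preserves both orders, as an embedding of models. -/
def modelEmbedding {n n' : ℕ} (σ : Perm (Fin n)) (σ' : Perm (Fin n')) (f : Fin n → Fin n')
    (hf : StrictMono f) (hv : ∀ x y, σ x < σ y → σ' (f x) < σ' (f y)) :
    @FirstOrder.Language.Embedding lang (Fin n) (Fin n') (model σ) (model σ') :=
  letI := model σ
  letI := model σ'
  { toFun := f
    inj' := hf.injective
    map_fun' := fun g => Empty.elim g
    map_rel' := fun R x => by
      cases R
      · exact hf.lt_iff_lt
      · refine ⟨fun h => ?_, hv _ _⟩
        rcases lt_trichotomy (σ (x 0)) (σ (x 1)) with h' | h' | h'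
        · exact h'
        · have h0 : σ' (f (x 0)) < σ' (f (x 1)) := h
          rw [σ.injective h'] at h0
          exact absurd h0 (lt_irrefl _)
        · exact absurd (hv _ _ h') (not_lt_of_gt h) }

section Shift

variable {n : ℕ} {α : Perm (Fin n)} {M M' : Fin n → ℕ} {b : Fin n → Bool} {ρ ρ' : SizedPerm}
  {e : (Σ j : Fin n, Fin (M j)) ≃ Fin ρ.1} {e' : (Σ j : Fin n, Fin (M' j)) ≃ Fin ρ'.1} {j₀ : Fin n}

/-- Leave out the point number `c` of the block `j₀`. -/
def blockShift (hM : ∀ j, M' j = M j + if j = j₀ then 1 else 0) (c : ℕ)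
    (p : Σ j : Fin n, Fin (M j)) : Σ j : Fin n, Fin (M' j) :=
  ⟨p.1, p.2 + if p.1 = j₀ ∧ c ≤ p.2 then 1 else 0, by
    rw [hM]
    split_ifs <;> omega⟩

theorem blockShift_congr (hM : ∀ j, M' j = M j + if j = j₀ then 1 else 0) {c c' : ℕ}
    {p : Σ j : Fin n, Fin (M j)} (h : c ≤ p.2 ↔ c' ≤ p.2) :
    blockShift hM c p = blockShift hM c' p := by
  simp [blockShift, h]

theorem blockShift_of_ne (hM : ∀ j, M' j = M j + if j = j₀ then 1 else 0) (c : ℕ)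
    {p : Σ j : Fin n, Fin (M j)} {q : Σ j : Fin n, Fin (M' j)} (h : p.1 ≠ j₀) (h1 : p.1 = q.1)
    (h2 : (p.2 : ℕ) = q.2) : blockShift hM c p = q := by
  obtain ⟨j, x⟩ := p
  obtain ⟨j', y⟩ := q
  obtain rfl : j = j' := h1
  have h3 : (x : ℕ) = y := h2
  have h4 : j ≠ j₀ := h
  simp [blockShift, h4, h3]

/-- Point `y` of the block `j₀` is missed only for `c = y`: for smaller `c` it comes from `y - 1`,
for larger `c` from `y`, when that point exists. Points of other blocks never move. -/
theorem exists_blockShift_eq (hM : ∀ j, M' j = M j + if j = j₀ then 1 else 0)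
    (q : Σ j : Fin n, Fin (M' j)) : ∃ t, (t = 0 ∨ ∃ p, ∀ c < t, blockShift hM c p = q) ∧
      (M j₀ ≤ t ∨ ∃ p, ∀ c > t, blockShift hM c p = q) := by
  obtain ⟨j, y⟩ := q
  have hy : (y : ℕ) < M j + if j = j₀ then 1 else 0 := lt_of_lt_of_eq y.2 (hM j)
  by_cases hj : j = j₀
  · subst hj
    rw [if_pos rfl] at hy
    have key : ∀ (c : ℕ) (x : Fin (M j)), ((x : ℕ) + if c ≤ x then 1 else 0) = y →
        blockShift hM c ⟨j, x⟩ = ⟨j, y⟩ := fun c x h => by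
      simp [blockShift, h]
    refine ⟨y, ?_, ?_⟩
    · rcases Nat.eq_zero_or_pos y with h0 | h0
      · exact .inl h0
      · refine .inr ⟨⟨j, ⟨y - 1, by omega⟩⟩, fun c hc => key _ _ ?_⟩
        simp only
        split_ifs <;> omega
    · rcases Nat.lt_or_ge y (M j) with h0 | h0
      · refine .inr ⟨⟨j, ⟨y, h0⟩⟩, fun c hc => key _ _ ?_⟩
        simp only
        split_ifs <;> omega
      · exact .inl h0
  · rw [if_neg hj] at hy
    exact ⟨0, .inl rfl, .inr ⟨⟨j, ⟨y, hy⟩⟩, fun c _ => blockShift_of_ne hM c hj rfl rfl⟩⟩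

theorem blockShift_lt (hM : ∀ j, M' j = M j + if j = j₀ then 1 else 0) (c : ℕ) {j : Fin n}
    {x y : Fin (M j)} (h : x < y) : (blockShift hM c ⟨j, x⟩).2 < (blockShift hM c ⟨j, y⟩).2 := by
  have : x.val < y.val := h
  change (x : ℕ) + _ < (y : ℕ) + _
  simp only
  split_ifs <;> omega

theorem IsInflationEquiv.blockShift_lt (hM : ∀ j, M' j = M j + if j = j₀ then 1 else 0)
    (h : IsInflationEquiv α (fun j => ⟨M j, monoPerm (b j) (M j)⟩) ρ e)
    (h' : IsInflationEquiv α (fun j => ⟨M' j, monoPerm (b j) (M' j)⟩) ρ' e') (c : ℕ)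
    {p p' : Σ j : Fin n, Fin (M j)} (hp : e p < e p') :
    e' (blockShift hM c p) < e' (blockShift hM c p') := by
  obtain ⟨j, x⟩ := p
  obtain ⟨j', y⟩ := p'
  rcases lt_trichotomy j j' with hj | rfl | hj
  · exact h'.2.2.1 _ _ _ _ hj
  · exact (h'.1 _ _ _).2 (TOTO.blockShift_lt hM c ((h.1 _ _ _).1 hp))
  · exact absurd hp (h.2.2.1 _ _ _ _ hj).not_gt

theorem IsInflationEquiv.val_blockShift_lt (hM : ∀ j, M' j = M j + if j = j₀ then 1 else 0)
    (h : IsInflationEquiv α (fun j => ⟨M j, monoPerm (b j) (M j)⟩) ρ e)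
    (h' : IsInflationEquiv α (fun j => ⟨M' j, monoPerm (b j) (M' j)⟩) ρ' e') (c : ℕ)
    {p p' : Σ j : Fin n, Fin (M j)} (hp : ρ.2 (e p) < ρ.2 (e p')) :
    ρ'.2 (e' (blockShift hM c p)) < ρ'.2 (e' (blockShift hM c p')) := by
  obtain ⟨j, x⟩ := p
  obtain ⟨j', y⟩ := p'
  rcases lt_trichotomy (α j) (α j') with hj | hj | hj
  · exact h'.2.2.2 _ _ _ _ hj
  · obtain rfl := α.injective hj
    let f : Fin (M j) → Fin (M' j) := fun x => (blockShift hM c ⟨j, x⟩).2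
    have hmono : StrictMono f := fun _ _ => TOTO.blockShift_lt hM c
    exact (h'.2.1 _ _ _).2 (monoPerm_lt_monoPerm (b := b j) hmono ((h.2.1 _ _ _).1 hp))
  · exact absurd hp (h.2.2.2 _ _ _ _ hj).not_gt

/-- The embeddings of an inflation into the inflation with one more point in the monotone block
`j₀`. -/
def shiftFamily (hM : ∀ j, M' j = M j + if j = j₀ then 1 else 0)
    (h : IsInflationEquiv α (fun j => ⟨M j, monoPerm (b j) (M j)⟩) ρ e)
    (h' : IsInflationEquiv α (fun j => ⟨M' j, monoPerm (b j) (M' j)⟩) ρ' e') :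
    @ShiftFamily lang (Fin ρ.1) (Fin ρ'.1) (model ρ.2) (model ρ'.2) (M j₀) :=
  letI := model ρ.2
  letI := model ρ'.2
  { emb := fun c => modelEmbedding ρ.2 ρ'.2 (fun x => e' (blockShift hM c (e.symm x)))
      (fun x y hxy => h.blockShift_lt hM h' c
        (by rwa [e.apply_symm_apply, e.apply_symm_apply]))
      (fun x y hxy => h.val_blockShift_lt hM h' c
        (by rwa [e.apply_symm_apply, e.apply_symm_apply]))
    image_jump := fun x => ⟨(e.symm x).2,
      fun c hc c' hc' => congrArg e' (blockShift_congr hM (by omega)),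
      fun c hc c' hc' => congrArg e' (blockShift_congr hM (by omega))⟩
    preimage_jump := fun y => by
      have key : ∀ c p, blockShift hM c p = e'.symm y →
          e' (blockShift hM c (e.symm (e p))) = y := fun c p hp => by
        rw [e.symm_apply_apply, hp, e'.apply_symm_apply]
      obtain ⟨t, h1, h2⟩ := exists_blockShift_eq hM (e'.symm y)
      exact ⟨t, h1.imp_right fun ⟨p, hp⟩ => ⟨e p, fun c hc _ => key c p (hp c hc)⟩,
        h2.imp_right fun ⟨p, hp⟩ => ⟨e p, fun c hc _ => key c p (hp c hc)⟩⟩ }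

/-- Marked points lie outside `j₀`, so their images are independent of `c` and back-and-forth can
use the whole interval from `0` to `M j₀`. -/
theorem exists_satisfies_iff_of_large_block {k : ℕ} (φ : lang.Formula (Fin k)) :
    ∃ d, ∀ {n : ℕ} {α : Perm (Fin n)} {M M' : Fin n → ℕ} {b : Fin n → Bool} {ρ ρ' : SizedPerm}
      {e : (Σ j : Fin n, Fin (M j)) ≃ Fin ρ.1} {e' : (Σ j : Fin n, Fin (M' j)) ≃ Fin ρ'.1}
      {j₀ : Fin n}, (∀ j, M' j = M j + if j = j₀ then 1 else 0) →
      ∀ (h : IsInflationEquiv α (fun j => ⟨M j, monoPerm (b j) (M j)⟩) ρ e)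
      (h' : IsInflationEquiv α (fun j => ⟨M' j, monoPerm (b j) (M' j)⟩) ρ' e')
      {s : Fin k ↪o Fin n}, (∀ l, s l ≠ j₀) → ∀ (hs : ∀ l, M (s l) = 1) (hs' : ∀ l, M' (s l) = 1),
      d ≤ M j₀ → ∀ κ : Perm (Fin k),
        (Satisfies ρ.2 (h.marked hs ∘ κ) φ ↔ Satisfies ρ'.2 (h'.marked hs' ∘ κ) φ) := by
  obtain ⟨d, hd⟩ := ShiftFamily.realize_iff_of_long_interval φ
  refine ⟨d, fun {n α M M' b ρ ρ' e e' j₀} hM h h' s hj hs hs' hdM κ => ?_⟩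
  let _ := model ρ.2
  let _ := model ρ'.2
  refine hd _ _ _ (shiftFamily hM h h') 0 (M j₀) (by omega) le_rfl _ _ _ _ (fun c _ _ l => ?_)
    fun _ _ _ x => x.elim0
  refine congrArg e' ((congrArg (blockShift hM c) (e.symm_apply_apply _)).trans ?_)
  exact blockShift_of_ne hM c (hj _) rfl rfl

end Shift

/-! ### Inexpressibility -/

theorem monoPerm_mem_monoClass (b : Bool) (n : ℕ) : (⟨n, monoPerm b n⟩ : SizedPerm) ∈ monoClass b := by
  cases b
  · exact fun x y hxy => by simpa [monoPerm] using hxy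
  · exact fun x y hxy => by simpa [monoPerm] using hxy

theorem finRotate_ne_self {r : ℕ} (hr : 2 ≤ r) (t : Fin r) : finRotate r t ≠ t := by
  have : t ∈ (finRotate r).support := by simp [support_finRotate_of_le hr]
  exact Perm.mem_support.1 this

/-- If `C` contains all the inflated expansions of some kind, no formula distinguishes, in `C`,
stable from unstable occurrences of `π`. -/
theorem exists_indistinguishable {C : Set SizedPerm} {k : ℕ} {π : Perm (Fin k)}
    (h : ¬ AvoidsSomeInEach C π) (φ : lang.Formula (Fin k)) (κ : Perm (Fin k)) :
    ∃ ρ ∈ C, ∃ ρ' ∈ C, ∃ (z : Fin k ↪o Fin ρ.1) (z' : Fin k ↪o Fin ρ'.1),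
      IsStableOccurrence π ρ.2 z ∧ IsOccurrence π ρ'.2 z' ∧ ¬ IsStableOccurrence π ρ'.2 z' ∧
        (Satisfies ρ.2 (z ∘ κ) φ ↔ Satisfies ρ'.2 (z' ∘ κ) φ) := by
  classical
  simp only [AvoidsSomeInEach, not_forall, not_exists, not_and, not_not] at h
  obtain ⟨r, hr, i, hi, X, hX, hC⟩ := h
  have hXb : ∀ t, ∃ b, X t = monoClass b := fun t =>
    (hX t).elim (fun h => ⟨true, h⟩) fun h => ⟨false, h⟩
  choose v hv using hXb
  obtain ⟨E, s, hE⟩ := exists_isExpansion π hi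
  have hcard : (Finset.univ \ Finset.univ.map s.toEmbedding).card = r := by
    rw [Finset.card_sdiff_of_subset (Finset.subset_univ _)]
    simp
  let u := (Finset.univ \ Finset.univ.map s.toEmbedding).orderEmbOfFin hcard
  have hu : Set.range u = (Set.range s)ᶜ := by
    rw [Finset.range_orderEmbOfFin]
    ext x
    simp
  have hun : ∀ t l, s l ≠ u t := fun t l hl =>
    (hu ▸ Set.mem_range_self t : u t ∈ (Set.range s)ᶜ) ⟨l, hl⟩
  let t₀ : Fin r := ⟨0, by omega⟩
  let b : Fin (k + r) → Bool := fun j => decide (∃ t, u t = j ∧ v t = true)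
  have hb : ∀ t, b (u t) = v t := fun t => by
    rw [Bool.eq_iff_iff, decide_eq_true_iff]
    exact ⟨fun ⟨t', h1, h2⟩ => u.injective h1 ▸ h2, fun h => ⟨t, rfl, h⟩⟩
  have hmem : ∀ (M : Fin (k + r) → ℕ) ρ e, (∀ l, M (s l) = 1) →
      IsInflationEquiv E (fun j => ⟨M j, monoPerm (b j) (M j)⟩) ρ e → ρ ∈ C := by
    intro M ρ e hM he
    refine hC ρ ⟨fun t => ⟨M (u t), monoPerm (b (u t)) (M (u t))⟩, ρ, fun t => ?_,
      ⟨E, s, u, fun j => ⟨M j, monoPerm (b j) (M j)⟩, hE, hu, fun l => ?_, fun t => rfl, e, he⟩,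
      ⟨RelEmbedding.refl _, fun _ _ => Iff.rfl⟩⟩
    · rw [hv, ← hb]
      exact monoPerm_mem_monoClass _ _
    · beta_reduce
      rw [hM l, Subsingleton.elim (monoPerm (b (s l)) 1) 1]
  obtain ⟨d, hd⟩ := exists_satisfies_iff_of_large_block φ
  let M : Fin (k + r) → ℕ := fun j => if j ∈ Set.range s then 1 else d
  let M' : Fin (k + r) → ℕ := fun j => M j + if j = u t₀ then 1 else 0
  have hM : ∀ l, M (s l) = 1 := fun l => by simp [M]
  have hM' : ∀ l, M' (s l) = 1 := fun l => by simp [M', hM, hun]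
  obtain ⟨ρ, e, he⟩ := exists_isInflationEquiv E fun j => ⟨M j, monoPerm (b j) (M j)⟩
  obtain ⟨ρ', e', he'⟩ := exists_isInflationEquiv E fun j => ⟨M' j, monoPerm (b j) (M' j)⟩
  have hEs := hE.1.1.stable_iff_apply.1 hE.1
  -- `E` preserves the marked set and all unmarked blocks have size `d`. Block sizes thus agree
  -- along `E`, which makes the sums over positions and over values equal.
  have hME : ∀ j, M (E j) = M j := by
    intro j
    have : E j ∈ Set.range s ↔ j ∈ Set.range s := by
      constructor
      · rintro ⟨l, hl⟩
        exact ⟨π.symm l, E.injective (by rw [hEs, apply_symm_apply, hl])⟩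
      · rintro ⟨l, rfl⟩
        exact ⟨π l, (hEs l).symm⟩
    simp only [M, this]
  have hsum : ∀ a, ∑ j with E j < a, M j = ∑ j with j < a, M j := by
    intro a
    simp only [Finset.sum_filter]
    rw [← Equiv.sum_comp E fun j => if j < a then M j else 0]
    simp only [hME]
  refine ⟨ρ, hmem M ρ e hM he, ρ', hmem M' ρ' e' hM' he', he.marked hM, he'.marked hM',
    (he.isStableOccurrence_marked_iff hM hE.1).2 fun l => hsum _,
    he'.isOccurrence_marked hM' hE.1.1, fun hst => ?_,
    hd (fun j => rfl) he he' (fun l => hun t₀ l) hM hM' ?_ κ⟩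
  -- Only the extra point can break the equality of the sums. Stability would put `u t₀` and its
  -- value on the same side of every marked point, so its row and column would coincide; but these
  -- are consecutive entries of a cycle of length at least `2`.
  · rw [he'.isStableOccurrence_marked_iff hM' hE.1] at hst
    simp only [M', Finset.sum_add_distrib, hsum, add_right_inj, Finset.sum_ite_eq',
      Finset.mem_filter, Finset.mem_univ, true_and] at hst
    obtain ⟨q, h1, h2⟩ := hE.exists_cell (hun t₀)
    rw [show E ∘ s = s ∘ π from funext hEs, numBelow_comp_perm] at h1
    have heq : numBelow s (E (u t₀)) = numBelow s (u t₀) := by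
      have hne : E (u t₀) ∉ Set.range s := by
        rintro ⟨l, hl⟩
        refine hun t₀ (π.symm l) (E.injective ?_)
        rw [hEs, apply_symm_apply, hl]
      unfold numBelow
      congr 1
      ext l
      have h3 : E (u t₀) < s l ↔ u t₀ < s l := by
        have := hst l
        split_ifs at this with h1 h2 h2 <;> tauto
      simp only [Finset.mem_filter, Finset.mem_univ, true_and]
      rw [← not_iff_not, not_lt, not_lt, le_iff_lt_or_eq, le_iff_lt_or_eq, h3,
        or_iff_left fun h => hne ⟨l, h.symm⟩, or_iff_left fun h => hun t₀ l h.symm]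
    refine finRotate_ne_self hr q (hi (Fin.ext ?_))
    rw [← h1, ← h2, heq]
  · have : u t₀ ∉ Set.range s := fun ⟨l, hl⟩ => hun t₀ l hl
    exact (if_neg this).ge

/-! ### Cycles and stable occurrences -/

/-- A tuple of distinct elements is an occurrence of some pattern, in some order. -/
theorem exists_occurrence {k n : ℕ} (σ : Perm (Fin n)) {a : Fin k → Fin n}
    (ha : Function.Injective a) : ∃ (π e : Perm (Fin k)) (s : Fin k ↪o Fin n),
      IsOccurrence π σ s ∧ a = s ∘ e := by
  obtain ⟨e, he⟩ := exists_orderEquiv (Fintype.card_fin k) ha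
  let s : Fin k ↪o Fin n := OrderEmbedding.ofStrictMono (a ∘ e.symm) fun x y hxy =>
    (he _ _).1 (by simpa using hxy)
  obtain ⟨π, hπ⟩ := exists_orderEquiv (Fintype.card_fin k) (σ.injective.comp s.injective)
  refine ⟨π, e, s, hπ, ?_⟩
  funext x
  exact (congrArg a (e.symm_apply_apply x)).symm

section Translate

variable {k n : ℕ} {π e : Perm (Fin k)} {σ : Perm (Fin n)} {s : Fin k ↪o Fin n}

theorem IsStableOccurrence.isCycleTuple_iff (h : IsStableOccurrence π σ s) (a : Fin k → Fin k) :
    IsCycleTuple σ (s ∘ a) ↔ IsCycleTuple π a := by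
  have hs := h.1.stable_iff_apply.1 h
  simp [IsCycleTuple, hs, s.injective.of_comp_iff]

theorem mapsTo_range_of_isCycleTuple {a : Fin k → Fin n} (h : IsCycleTuple σ a) :
    Set.MapsTo σ (Set.range a) (Set.range a) := by
  rintro _ ⟨t, rfl⟩
  exact ⟨_, (h.2.2 t).symm⟩

theorem mapsTo_range_of_isUnionOfCycles {a : Fin k → Fin n} (h : IsUnionOfCycles σ a) :
    Set.MapsTo σ (Set.range a) (Set.range a) := by
  rintro _ ⟨t, rfl⟩
  exact h.2 t _ ⟨1, by simp⟩

theorem isUnionOfCycles_of_mapsTo {a : Fin k → Fin n} (ha : Function.Injective a)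
    (h : Set.MapsTo σ (Set.range a) (Set.range a)) : IsUnionOfCycles σ a := by
  refine ⟨ha, fun t y hy => ?_⟩
  obtain ⟨m, -, rfl⟩ := hy.exists_pow_eq'
  clear hy
  induction m with
  | zero => exact ⟨t, rfl⟩
  | succ m ih =>
    rw [pow_succ', Perm.mul_apply]
    exact h ih

end Translate

/-- Expressibility in `C` of a property of tuples which holds only for tuples whose set of entries
is mapped to itself. -/
theorem expressible_iff_forall_avoids {C : Set SizedPerm} (hC : IsPermClass C) {k : ℕ}
    (P : ∀ n : ℕ, Perm (Fin n) → (Fin k → Fin n) → Prop) (Q : Perm (Fin k) → Perm (Fin k) → Prop)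
    (hP : ∀ n (σ : Perm (Fin n)) a, P n σ a →
      Function.Injective a ∧ Set.MapsTo σ (Set.range a) (Set.range a))
    (hPQ : ∀ n (σ : Perm (Fin n)) (s : Fin k ↪o Fin n) (π e : Perm (Fin k)), IsStableOccurrence π σ s →
      (P n σ (s ∘ e) ↔ Q π e)) :
    (∃ φ : lang.Formula (Fin k), ∀ σ ∈ C, ∀ a : Fin k → Fin σ.1,
      Satisfies σ.2 a φ ↔ P σ.1 σ.2 a) ↔ ∀ π, (∃ e, Q π e) → AvoidsSomeInEach C π := by
  have hrange : ∀ (e : Perm (Fin k)) {n : ℕ} (s : Fin k ↪o Fin n),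
      Set.range (s ∘ e) = Set.range s := fun e n s => by
    rw [Set.range_comp, e.surjective.range_eq, Set.image_univ]
  constructor
  · rintro ⟨φ, hφ⟩ π ⟨e, he⟩
    -- The formula would take the same truth value on a stable occurrence with `P` and on an
    -- unstable one, where `P` fails for lack of invariance.
    by_contra hav
    obtain ⟨ρ, hρ, ρ', hρ', z, z', h1, h2, h3, h4⟩ := exists_indistinguishable hav φ e
    rw [hφ _ hρ, hφ _ hρ', hPQ _ _ _ _ _ h1] at h4
    have h5 := (hP _ _ _ (h4.1 he)).2
    rw [hrange] at h5
    exact h3 ⟨h2, h5⟩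
  · intro h
    obtain ⟨φ, hφ⟩ := exists_formula_of_forall_avoids hC Q fun π e he => h π ⟨e, he⟩
    refine ⟨φ, fun σ hσ a => (hφ σ hσ a).trans ⟨?_, fun ha => ?_⟩⟩
    · rintro ⟨π, e, hq, s, hs, rfl⟩
      exact (hPQ _ _ _ _ _ hs).2 hq
    · obtain ⟨hinj, hmaps⟩ := hP _ _ _ ha
      obtain ⟨π, e, s, hs, rfl⟩ := exists_occurrence σ.2 hinj
      rw [hrange] at hmaps
      exact ⟨π, e, (hPQ _ _ _ _ _ ⟨hs, hmaps⟩).1 ha, s, ⟨hs, hmaps⟩, rfl⟩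

theorem exists_isCycleTuple_perm_iff {k : ℕ} (π : Perm (Fin k)) :
    (∃ e : Perm (Fin k), IsCycleTuple π e) ↔ IsFullCycle π :=
  ⟨fun ⟨e, he⟩ => ⟨e, he⟩, fun ⟨a, ha⟩ =>
    ⟨Equiv.ofBijective a (Finite.injective_iff_bijective.1 ha.2.1), ha⟩⟩

end TOTO

/-! ### Expressibility of cycles and of unions of cycles -/

theorem mainTheorem6 (C : Set TOTO.SizedPerm) (hC : TOTO.IsPermClass C) (k : ℕ) :
    ((∃ φ : TOTO.lang.Formula (Fin k), ∀ σ ∈ C, ∀ a : Fin k → Fin σ.1,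
        TOTO.Satisfies σ.2 a φ ↔ TOTO.IsCycleTuple σ.2 a) ↔
      ∀ π : Equiv.Perm (Fin k), TOTO.IsFullCycle π → TOTO.AvoidsSomeInEach C π) ∧
    ((∃ φ : TOTO.lang.Formula (Fin k), ∀ σ ∈ C, ∀ a : Fin k → Fin σ.1,
        TOTO.Satisfies σ.2 a φ ↔ TOTO.IsCycleSet σ.2 a) ↔
      ∀ π : Equiv.Perm (Fin k), TOTO.IsFullCycle π → TOTO.AvoidsSomeInEach C π) ∧
    ((∃ φ : TOTO.lang.Formula (Fin k), ∀ σ ∈ C, ∀ a : Fin k → Fin σ.1,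
        TOTO.Satisfies σ.2 a φ ↔ TOTO.IsUnionOfCycles σ.2 a) ↔
      ∀ π : Equiv.Perm (Fin k), TOTO.AvoidsSomeInEach C π) := by
  refine ⟨?_, ?_, ?_⟩
  · refine (TOTO.expressible_iff_forall_avoids hC (fun n σ a => TOTO.IsCycleTuple σ a)
      (fun π e => TOTO.IsCycleTuple π e)
      (fun n σ a h => ⟨h.2.1, TOTO.mapsTo_range_of_isCycleTuple h⟩)
      fun n σ s π e hs => hs.isCycleTuple_iff e).trans ?_
    simp only [TOTO.exists_isCycleTuple_perm_iff]
  · have hrange : ∀ {n : ℕ} (a : Fin k → Fin n) (e : Equiv.Perm (Fin k)),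
        Set.range (a ∘ e) = Set.range a := fun a e => e.surjective.range_comp a
    refine (TOTO.expressible_iff_forall_avoids hC (fun n σ a => TOTO.IsCycleSet σ a)
      -- The listing order is immaterial here, since the property already allows reordering.
      (fun π _ => TOTO.IsFullCycle π) ?_ ?_).trans ?_
    · rintro n σ a ⟨e, he⟩
      have hm := TOTO.mapsTo_range_of_isCycleTuple he
      rw [hrange] at hm
      exact ⟨(e.injective_comp a).1 he.2.1, hm⟩
    · intro n σ s π e hs
      rw [← TOTO.exists_isCycleTuple_perm_iff]
      constructor
      · rintro ⟨e', he'⟩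
        exact ⟨e'.trans e, (hs.isCycleTuple_iff _).1 he'⟩
      · rintro ⟨e', he'⟩
        refine ⟨e'.trans e.symm, ?_⟩
        have : (s ∘ e) ∘ (e'.trans e.symm) = s ∘ e' := by
          funext x
          simp
        rw [this]
        exact (hs.isCycleTuple_iff _).2 he'
    · simp
  · refine (TOTO.expressible_iff_forall_avoids hC (fun n σ a => TOTO.IsUnionOfCycles σ a)
      (fun _ _ => True) (fun n σ a h => ⟨h.1, TOTO.mapsTo_range_of_isUnionOfCycles h⟩)
      fun n σ s π e hs => ?_).trans (by simp)
    refine iff_true_intro (TOTO.isUnionOfCycles_of_mapsTo (s.injective.comp e.injective) ?_)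
    rw [e.surjective.range_comp]
    exact hs.2
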